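/- Let $k$ be a field, $n\ge 1$, and let $Q$ be a quiver of type $\mathbb{A}_n$: its vertices are $1,\dots,n$, and for each $1\le i<n$ there is exactly one arrow between $i$ and $i+1$, in one of the two directions, and there are no other arrows. A module is a finite-dimensional representation of $Q$ over $k$; for a module $M$ let $\underline{\dim}\,M=(\dim M_1,\dots,\dim M_n)\in\mathbb{R}^n$ and let $\operatorname{supp}M$ be the set of vertices $i$ with $M_i\neq 0$. For a full subquiver $Q'$ of $Q$ with $m\ge 0$ vertices, a tilting module over $Q'$ is a module $T=\bigoplus_{i=1}^{m}T(i)$ over $Q'$ with $T(i)$ indecomposable and pairwise non-isomorphic, and $\mathrm{Ext}^1(T,T)=0$. A support tilting module is a module over $Q$ whose restriction to its support is a tilting module (over the full subquiver on the support; the zero module is included). A $2$-support tilting module is a pair $(T^+,T^-)$ of support tilting modules whose supports are disjoint with union $\{1,\dots,n\}$. Write $e_1,\dots,e_n$ for the standard basis of $\mathbb{R}^n$, and $D(M)$ for the set of dimension vectors of the indecomposable direct summands of $M$. Put $$P^+(Q)=\bigcup_{T\ \text{tilting}}\operatorname{conv}\bigl(D(T)\cup\{0\}\bigr),$$ $$P^{\mathrm{clus}}(Q)=\bigcup_{T\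 \text{support tilting}}\operatorname{conv}\bigl(D(T)\cup\{-e_j: j\notin\operatorname{supp}T\}\cup\{0\}\bigr),$$ $$P(Q)=\bigcup_{(T^+,T^-)\ 2\text{-support tilting}}\operatorname{conv}\bigl(D(T^+)\cup(-D(T^-))\cup\{0\}\bigr).$$ Let $\Phi^+=\{e_i+e_{i+1}+\dots+e_j : 1\le i\le j\le n\}$ be the set of positive roots of type $\mathbb{A}_n$ in the coordinates of the simple roots $e_1,\dots,e_n$, and put $$C^+(Q)=\operatorname{conv}(\Phi^+\cup\{0\}),\quad C^{\mathrm{clus}}(Q)=\operatorname{conv}(\Phi^+\cup\{-e_1,\dots,-e_n\}),\quad C(Q)=\operatorname{conv}(\Phi^+\cup-\Phi^+).$$ Then $$C(Q)=P(Q),\qquad C^{\mathrm{clus}}(Q)=P^{\mathrm{clus}}(Q),\qquad C^+(Q)=P^+(Q).$$ In particular $P(Q)$, $P^{\mathrm{clus}}(Q)$ and $P^+(Q)$ do not depend on the orientation of $Q$. -/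

import Mathlib

open CategoryTheory CategoryTheory.Limits

universe u v v' w

noncomputable section

namespace QuiverTilting

/-- A quiver on the vertices `0, …, n - 1` is of type `A_n` (with some orientation) if every arrow
joins two consecutive vertices, and between any two consecutive vertices there is exactly one arrow,
in one of the two directions. -/
structure IsTypeA {n : ℕ} (Q : Quiver.{v} (Fin n)) : Prop where
  adjacent : ∀ i j : Fin n, Nonempty (Q.Hom i j) →
    (i : ℕ) + 1 = (j : ℕ) ∨ (j : ℕ) + 1 = (i : ℕ)
  existsUnique_arrow : ∀ i j : Fin n, (i : ℕ) + 1 = (j : ℕ) →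
    Nonempty (Unique (Q.Hom i j ⊕ Q.Hom j i))

section Representations

variable (k : Type u) [Field k] {V : Type w}

/-- The abelian category of `k`-linear representations of the quiver `Q`, as functors on its path
category: a vector space for every vertex and a linear map for every arrow. -/
abbrev QRep (Q : Quiver.{v} V) : Type _ :=
  Paths V ⥤ ModuleCat.{u} k

variable {k} {Q : Quiver.{v} V}

/-- The vector space of a representation at a vertex. -/
abbrev QRep.space (M : QRep k Q) (i : V) : ModuleCat.{u} k :=
  M.obj ((Paths.of V).obj i)

/-- The representation is finite dimensional at every vertex. -/
def IsFinDim (M : QRep k Q) : Prop :=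
  ∀ i : V, FiniteDimensional k (M.space i)

/-- The dimension vector of a representation. -/
def dimVec (M : QRep k Q) (i : V) : ℕ :=
  Module.finrank k (M.space i)

/-- The dimension vector, as a point of the real vector space with coordinates indexed by the
vertices. -/
def realDimVec (M : QRep k Q) (i : V) : ℝ :=
  (dimVec M i : ℝ)

/-- The support of a representation is the support of its dimension vector. -/
def supp (M : QRep k Q) : Set V :=
  {i | dimVec M i ≠ 0}

/-- A representation is rigid if `Ext¹(M, M) = 0` in the category of representations. -/
def IsRigid (M : QRep k Q) : Prop :=
  letI : HasExt (QRep k Q) := HasExt.standard (QRep k Q)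
  Subsingleton (Abelian.Ext M M 1)

/-- `N` is an indecomposable direct summand of `M`. -/
def IsIndecSummand (N M : QRep k Q) : Prop :=
  Indecomposable N ∧ ∃ N' : QRep k Q, Nonempty (M ≅ N ⊞ N')

/-- A tilting module: a finite dimensional module with `Ext¹(T, T) = 0` which is the direct sum of
as many pairwise non-isomorphic indecomposable modules as there are vertices. -/
def IsTilting (T : QRep k Q) : Prop :=
  haveI : HasFiniteBiproducts (QRep k Q) := Abelian.hasFiniteBiproducts
  IsFinDim T ∧ IsRigid T ∧
    ∃ X : Fin (Nat.card V) → QRep k Q,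
      (∀ i, Indecomposable (X i)) ∧ (∀ i j, i ≠ j → IsEmpty (X i ≅ X j)) ∧ Nonempty (T ≅ ⨁ X)

/-- The full subquiver on a set of vertices. -/
abbrev fullSubquiver (Q : Quiver.{v} V) (S : Set V) : Quiver.{v} S :=
  ⟨fun i j => Q.Hom i.1 j.1⟩

/-- The inclusion of the path category of a full subquiver. -/
def pathsInclusion (Q : Quiver.{v} V) (S : Set V) :
    @Functor (@Paths S) (@Paths.categoryPaths S (fullSubquiver Q S)) (Paths V) _ :=
  letI := fullSubquiver Q S
  Paths.lift { obj := fun i => (Paths.of V).obj i.1, map := fun {i j} (f : Q.Hom i.1 j.1) =>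
    (Paths.of V).map f }

/-- The restriction of a representation to the full subquiver on a set of vertices. -/
def restrict (M : QRep k Q) (S : Set V) : QRep k (fullSubquiver Q S) :=
  letI := fullSubquiver Q S
  pathsInclusion Q S ⋙ M

/-- A support tilting module: a finite dimensional module whose restriction to its support is a
tilting module. -/
def IsSupportTilting (T : QRep k Q) : Prop :=
  IsFinDim T ∧ IsTilting (restrict T (supp T))

/-- A 2-support tilting module `T = T⁺ ⊕ T⁻`, given by its two parts: both are support tilting and
the set of vertices is the disjoint union of their supports. -/
def IsTwoSupportTilting (Tpos Tneg : QRep k Q) : Prop :=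
  IsSupportTilting Tpos ∧ IsSupportTilting Tneg ∧ IsCompl (supp Tpos) (supp Tneg)

/-- The dimension vectors of the indecomposable direct summands of `M`. -/
def summandDims (M : QRep k Q) : Set (V → ℝ) :=
  {d | ∃ N : QRep k Q, IsIndecSummand N M ∧ d = realDimVec N}

/-- The negatives of the standard basis vectors at the vertices outside `S`. -/
def negBasisOutside (S : Set V) : Set (V → ℝ) :=
  {d | ∃ j : V, j ∉ S ∧ d = -Set.indicator {j} 1}

/-- The simplex `σ_T` of a tilting module. -/
def simplexPlus (T : QRep k Q) : Set (V → ℝ) :=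
  convexHull ℝ (summandDims T ∪ {0})

/-- The simplex `σ_T` of a support tilting module. -/
def simplexClus (T : QRep k Q) : Set (V → ℝ) :=
  convexHull ℝ (summandDims T ∪ negBasisOutside (supp T) ∪ {0})

/-- The simplex `σ_T` of a 2-support tilting module `T = T⁺ ⊕ T⁻`. -/
def simplexTwo (Tpos Tneg : QRep k Q) : Set (V → ℝ) :=
  convexHull ℝ (summandDims Tpos ∪ {d | -d ∈ summandDims Tneg} ∪ {0})

variable (k) (Q)

/-- `P⁺(Q)`, the union of the simplices of all tilting modules. -/
def polyPPlus : Set (V → ℝ) :=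
  {x | ∃ T : QRep k Q, IsTilting T ∧ x ∈ simplexPlus T}

/-- `P^clus(Q)`, the union of the simplices of all support tilting modules. -/
def polyPClus : Set (V → ℝ) :=
  {x | ∃ T : QRep k Q, IsSupportTilting T ∧ x ∈ simplexClus T}

/-- `P(Q)`, the union of the simplices of all 2-support tilting modules. -/
def polyP : Set (V → ℝ) :=
  {x | ∃ Tpos Tneg : QRep k Q, IsTwoSupportTilting Tpos Tneg ∧ x ∈ simplexTwo Tpos Tneg}

end Representations

/-- The positive roots of type `A_n` in the coordinates of the simple roots: the vectors
`(0, …, 0, 1, …, 1, 0, …, 0)` whose entries `1` fill a nonempty interval `[i, j]`. -/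
def posRoots (n : ℕ) : Set (Fin n → ℝ) :=
  {d | ∃ i j : Fin n, i ≤ j ∧ d = Set.indicator (Set.Icc i j) 1}

/-- The simple roots of type `A_n`: the standard basis vectors. -/
def simpleRoots (n : ℕ) : Set (Fin n → ℝ) :=
  {d | ∃ i : Fin n, d = Pi.single i 1}

/-- `C⁺(A_n)`, the convex hull of the positive roots and `0`. -/
def polyCPlus (n : ℕ) : Set (Fin n → ℝ) :=
  convexHull ℝ (posRoots n ∪ {0})

/-- `C^clus(A_n)`, the convex hull of the positive roots and the negative simple roots. -/
def polyCClus (n : ℕ) : Set (Fin n → ℝ) :=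
  convexHull ℝ (posRoots n ∪ {d | -d ∈ simpleRoots n})

/-- `C(A_n)`, the convex hull of all roots. -/
def polyC (n : ℕ) : Set (Fin n → ℝ) :=
  convexHull ℝ (posRoots n ∪ {d | -d ∈ posRoots n})

end QuiverTilting

end

/-! The inclusions of the `P`-sets in the `C`-polytopes come from Gabriel's theorem in type A: an
indecomposable is the thin representation of an interval, so its dimension vector is a positive root
(`exists_iso_thinRep`, `IsLinear.summandDims_subset`).

For the converse, a point x is placed first in a cone, then in a simplex.

Cone: let S be the set of coordinates where x is nonnegative. `exists_isTiltingFamily` sweeps the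
line from left to right and keeps a weighted family of intervals in S, pairwise without extensions
and as many as the vertices of S met so far, which represents x on these vertices. At a new vertex n
of S, the intervals ending at n - 1 are sorted by a total order that controls extensions. An initial
stretch of them is prolonged to n and the next one is split into a part that is prolonged and a part
that is not; if their total weight is too small, all are prolonged and [n, n] is added.
`IsLinear.subsingleton_ext_one` turns the condition on intervals into the vanishing of Ext¹, so the
family consists of summands of a support tilting module. Negative coordinates are handled by
negative simple roots, or by the same construction for -x on the complement of S.

Simplex: intervals without extensions are never adjacent. With q the indicator of the left ends of
the family, the functional with coefficients q t - q (t + 1) telescopes to q a - q (b + 1) on the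
root of [a, b]; it is at most 1 on all roots and equal to 1 on the roots of the family. Extended to
the negative part, its value at x is the sum of all weights. This sum is therefore at most 1 for x
in the polytope, and the vertex 0 absorbs the rest. -/

noncomputable section

namespace QuiverTilting

/-! ### Vanishing of Ext¹ from the splitting of short exact sequences -/

section ExtOne

open CategoryTheory.Category

universe w₁ v₁ u₁

variable {C : Type u₁} [Category.{v₁} C] [Abelian C]

open HomologicalComplex in
/-- A quasi-isomorphism from a complex in degrees `≤ i` to an object placed in degree `i` becomes
an epimorphism of objects after restriction to the term of degree `i`. -/
lemma exists_epi_lift_of_quasiIso {X : C} {K : CochainComplex C ℤ} {i : ℤ}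
    (π : K ⟶ (single C (ComplexShape.up ℤ) i).obj X) [K.IsStrictlyLE i] [QuasiIsoAt π i] :
    ∃ (P : C) (g : P ⟶ X) (s : (single C (ComplexShape.up ℤ) i).obj P ⟶ K),
      Epi g ∧ s ≫ π = (single C (ComplexShape.up ℤ) i).map g := by
  have h0 : ∀ j, (ComplexShape.up ℤ).Rel i j → 𝟙 (K.X i) ≫ K.d i j = 0 := by
    intro j hj
    have hj : i + 1 = j := hj
    exact (K.isZero_of_isStrictlyLE i j (by lia)).eq_of_tgt _ _
  have h1 : K.d i (i + 1) = 0 := (K.isZero_of_isStrictlyLE i (i + 1) (by lia)).eq_of_tgt _ _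
  let e := K.iCyclesIso i (i + 1) (by simp) h1
  let α := e.inv ≫ K.homologyπ i ≫ homologyMap π i ≫ (singleObjHomologySelfIso _ _ X).hom
  have h : π.f i = α ≫ (singleObjXSelf (ComplexShape.up ℤ) i X).inv := by
    rw [← cancel_epi e.hom]
    dsimp only [α, e]
    rw [assoc, assoc, assoc, Iso.hom_inv_id_assoc, homologyπ_naturality_assoc,
      homologyπ_singleObjHomologySelfIso_hom_assoc,
      ← singleObjCyclesSelfIso_inv_iCycles, Iso.hom_inv_id_assoc, cyclesMap_i]
    rfl
  have hα : Epi α := by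
    have : IsIso (homologyMap π i) := inferInstance
    have h2 : Epi (homologyMap π i ≫ (singleObjHomologySelfIso (ComplexShape.up ℤ) i X).hom) :=
      inferInstance
    have h3 := epi_comp (K.homologyπ i) (homologyMap π i ≫
      (singleObjHomologySelfIso (ComplexShape.up ℤ) i X).hom)
    exact epi_comp e.inv _
  refine ⟨K.X i, α, mkHomFromSingle (𝟙 _) h0, hα, ?_⟩
  apply HomologicalComplex.from_single_hom_ext
  rw [comp_f, mkHomFromSingle_f, h, comp_id, single_map_f_self]

open DerivedCategory in
/-- A morphism in the derived category from an object in degree `i` to a complex in degrees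
`< i` is killed by an epimorphism. -/
lemma exists_epi_comp_singleFunctor_eq_zero [HasDerivedCategory.{w₁} C] {X : C}
    {L : CochainComplex C ℤ} {i : ℤ}
    (φ : Q.obj ((CochainComplex.singleFunctor C i).obj X) ⟶ Q.obj L)
    (n : ℤ) (hn : n < i) [L.IsStrictlyLE n] :
    ∃ (P : C) (g : P ⟶ X), Epi g ∧ Q.map ((CochainComplex.singleFunctor C i).map g) ≫ φ = 0 := by
  obtain ⟨K, _, π, h, f, rfl⟩ := right_fac_of_isStrictlyLE φ i
  rw [isIso_Q_map_iff_quasiIso] at h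
  have hπ : QuasiIsoAt (L := (HomologicalComplex.single C (ComplexShape.up ℤ) i).obj X) π i :=
    h.quasiIsoAt i
  obtain ⟨P, g, s, hg, hs⟩ := exists_epi_lift_of_quasiIso
    (π : K ⟶ (HomologicalComplex.single C (ComplexShape.up ℤ) i).obj X)
  change (CochainComplex.singleFunctor C i).obj P ⟶ K at s
  change s ≫ π = (CochainComplex.singleFunctor C i).map g at hs
  refine ⟨P, g, hg, ?_⟩
  have : IsIso (Q.map π) := by rwa [isIso_Q_map_iff_quasiIso]
  have hsf : s ≫ f = 0 := by
    apply HomologicalComplex.from_single_hom_ext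
    apply (L.isZero_of_isStrictlyLE n i hn).eq_of_tgt
  rw [← hs, Q.map_comp, assoc, IsIso.hom_inv_id_assoc, ← Q.map_comp, hsf, Q.map_zero]

open Abelian

open DerivedCategory in
-- A class of degree n + 1 is a derived morphism from X in degree 0 to Y in the negative degree -(n
-- + 1), so it is effaceable by the preceding lemma.
lemma exists_epi_comp_ext_eq_zero [HasExt.{w₁} C] {X Y : C} {n : ℕ} (e : Ext X Y (n + 1)) :
    ∃ (P : C) (g : P ⟶ X), Epi g ∧ (Ext.mk₀ g).comp e (zero_add _) = 0 := by
  let := HasDerivedCategory.standard C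
  obtain ⟨P, g, hg, h⟩ := exists_epi_comp_singleFunctor_eq_zero
    (L := (CochainComplex.singleFunctor C (-(n + 1))).obj Y)
    (e.hom ≫ ((singleFunctors C).shiftIso (n + 1) (-(n + 1)) 0 (by lia)).hom.app _) (-(n + 1))
    (by lia)
  refine ⟨P, g, hg, ?_⟩
  apply Ext.ext
  rw [Ext.zero_hom, Ext.comp_hom, Ext.mk₀_hom, ShiftedHom.mk₀_comp,
    ← cancel_mono (((singleFunctors C).shiftIso (n + 1) (-(n + 1)) 0 (by lia)).hom.app Y),
    zero_comp]
  exact (assoc _ _ _).trans h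

/-- If every short exact sequence with outer terms `Y` and `X` splits, then `Ext¹(X, Y)`
vanishes. -/
lemma subsingleton_ext_one_of_forall_retraction [HasExt.{w₁} C] {X Y : C}
    (H : ∀ (E : C) (f : Y ⟶ E) (g : E ⟶ X) (w : f ≫ g = 0),
      (ShortComplex.mk f g w).ShortExact → ∃ r : E ⟶ Y, f ≫ r = 𝟙 Y) :
    Subsingleton (Ext.{w₁} X Y 1) := by
  refine subsingleton_of_forall_eq 0 fun e => ?_
  obtain ⟨P, g, hg, h⟩ := exists_epi_comp_ext_eq_zero e
  let S := ShortComplex.mk _ _ (kernel.condition g)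
  have hS : S.ShortExact := { exact := ShortComplex.exact_of_f_is_kernel _ (kernelIsKernel S.g) }
  obtain ⟨y, rfl⟩ := Ext.contravariant_sequence_exact₃ hS Y e h (add_zero 1)
  obtain ⟨y, rfl⟩ := Ext.homEquiv₀.symm.surjective y
  -- The class e is the image of y under the connecting map. The pushout is the extension of X by Y
  -- that it represents; a retraction of it extends y to P, and classes of maps that extend to P are
  -- zero.
  let E := pushout S.f y
  have hd : S.f ≫ S.g = y ≫ 0 := by rw [S.zero, comp_zero]
  have w : pushout.inr S.f y ≫ pushout.desc S.g 0 hd = 0 := pushout.inr_desc _ _ _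
  have hE : (ShortComplex.mk _ _ w).ShortExact := by
    have : Epi (pushout.desc S.g 0 hd : pushout S.f y ⟶ X) :=
      epi_of_epi_fac (pushout.inl_desc S.g 0 hd)
    refine ShortComplex.ShortExact.mk' ?_ inferInstance this
    apply ShortComplex.exact_of_g_is_cokernel
    refine CokernelCofork.IsColimit.ofπ' _ _ fun {A} k hk => ?_
    have hk' : S.f ≫ pushout.inl S.f y ≫ k = 0 := by
      rw [pushout.condition_assoc, hk, comp_zero]
    refine ⟨hS.exact.desc _ hk', ?_⟩
    apply pushout.hom_ext
    · rw [pushout.inl_desc_assoc]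
      exact hS.exact.g_desc _ hk'
    · rw [pushout.inr_desc_assoc, zero_comp]
      exact hk.symm
  obtain ⟨r, hr⟩ := H _ _ _ w hE
  have hy : y = S.f ≫ pushout.inl S.f y ≫ r := by
    rw [pushout.condition_assoc, hr, comp_id]
  rw [Ext.homEquiv₀_symm_apply, hy, ← Ext.mk₀_comp_mk₀,
    ← Ext.comp_assoc (a₁₂ := 1) (a₂₃ := 0) _ _ _ (by lia) (by lia) (by lia),
    hS.extClass_comp, Ext.zero_comp]

end ExtOne

/-! ### Representations vertex by vertex, and the cocycle criterion for Ext¹ -/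

section Splitting

variable {k : Type u} [Field k] {V : Type w} {Q : Quiver.{v} V}

/-- The linear map of a representation at an arrow. -/
def QRep.arrowMap (M : QRep k Q) {i j : V} (f : Q.Hom i j) : M.space i →ₗ[k] M.space j :=
  (M.map ((Paths.of V).map f)).hom

/-- The linear map of a morphism of representations at a vertex. -/
def QRep.homAt {M N : QRep k Q} (α : M ⟶ N) (i : V) : M.space i →ₗ[k] N.space i :=
  (α.app ((Paths.of V).obj i)).hom

lemma QRep.homAt_arrowMap {M N : QRep k Q} (α : M ⟶ N) {i j : V} (f : Q.Hom i j)
    (x : M.space i) : homAt α j (M.arrowMap f x) = N.arrowMap f (homAt α i x) :=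
  LinearMap.congr_fun (congrArg ModuleCat.Hom.hom (α.naturality ((Paths.of V).map f))) x

/-- A morphism of representations, from its linear maps at the vertices. -/
def QRep.mkHom {M N : QRep k Q} (φ : ∀ i, M.space i →ₗ[k] N.space i)
    (h : ∀ (i j : V) (f : Q.Hom i j) (x : M.space i),
      φ j (M.arrowMap f x) = N.arrowMap f (φ i x)) : M ⟶ N :=
  Paths.liftNatTrans (fun i => ModuleCat.ofHom (φ i)) fun {i j} f => by
    ext x
    exact h i j f x

@[simp]
lemma QRep.homAt_mkHom {M N : QRep k Q} (φ : ∀ i, M.space i →ₗ[k] N.space i)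
    (h : ∀ (i j : V) (f : Q.Hom i j) (x : M.space i),
      φ j (M.arrowMap f x) = N.arrowMap f (φ i x)) (i : V) :
    homAt (mkHom φ h) i = φ i := rfl

@[simp]
lemma QRep.homAt_comp {M N L : QRep k Q} (α : M ⟶ N) (β : N ⟶ L) (i : V) (x : M.space i) :
    homAt (α ≫ β) i x = homAt β i (homAt α i x) := rfl

@[simp]
lemma QRep.homAt_id (M : QRep k Q) (i : V) (x : M.space i) : homAt (𝟙 M) i x = x := rfl

@[simp]
lemma QRep.homAt_zero (M N : QRep k Q) (i : V) (x : M.space i) :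
    homAt (0 : M ⟶ N) i x = 0 := rfl

lemma QRep.hom_ext {M N : QRep k Q} {α β : M ⟶ N} (h : ∀ i x, homAt α i x = homAt β i x) :
    α = β := by
  apply NatTrans.ext
  funext i
  apply ModuleCat.hom_ext
  exact LinearMap.ext (h i)

lemma QRep.shortExact_at {S : ShortComplex (QRep k Q)} (hS : S.ShortExact) (i : V) :
    Function.Injective (homAt S.f i) ∧ Function.Surjective (homAt S.g i) ∧
      Function.Exact (homAt S.f i) (homAt S.g i) := by
  have h := hS.map_of_exact ((evaluation (Paths V) (ModuleCat.{u} k)).obj ((Paths.of V).obj i))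
  exact ⟨h.moduleCat_injective_f, h.moduleCat_surjective_g,
    (ShortComplex.ShortExact.moduleCat_exact_iff_function_exact _).1 h.exact⟩

/-- The group `Ext¹(M, N)` of representations vanishes if every family of linear maps along the
arrows is a coboundary. -/
lemma QRep.subsingleton_ext_one [HasExt.{v'} (QRep k Q)] {M N : QRep k Q}
    (H : ∀ h : (∀ (i j : V), Q.Hom i j → (M.space i →ₗ[k] N.space j)),
      ∃ φ : ∀ i, M.space i →ₗ[k] N.space i, ∀ (i j : V) (f : Q.Hom i j) (x : M.space i),
        h i j f x = N.arrowMap f (φ i x) - φ j (M.arrowMap f x)) :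
    Subsingleton (Abelian.Ext M N 1) := by
  refine subsingleton_ext_one_of_forall_retraction fun E f g w hS => ?_
  have hex := shortExact_at hS
  choose r hr using fun i => LinearMap.exists_leftInverse_of_injective (homAt f i)
    (LinearMap.ker_eq_bot.2 (hex i).1)
  choose s hs using fun i => LinearMap.exists_rightInverse_of_surjective (homAt g i)
    (LinearMap.range_eq_top.2 (hex i).2.1)
  have hr' : ∀ i x, r i (homAt f i x) = x := fun i => LinearMap.congr_fun (hr i)
  have hs' : ∀ i x, homAt g i (s i x) = x := fun i => LinearMap.congr_fun (hs i)
  have hfg : ∀ i x, homAt g i (homAt f i x) = 0 := fun i => (hex i).2.2.apply_apply_eq_zero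
  -- The defect of the vertexwise retractions `r` along the arrows vanishes on N, hence descends to
  -- M through the sections `s`. Writing it as a coboundary of φ makes r + φ ∘ g a morphism.
  obtain ⟨φ, hφ⟩ := H fun i j a => (r j ∘ₗ E.arrowMap a - N.arrowMap a ∘ₗ r i) ∘ₗ s i
  have key : ∀ (i j : V) (a : Q.Hom i j) (x : E.space i),
      r j (E.arrowMap a x) - N.arrowMap a (r i x) =
        N.arrowMap a (φ i (homAt g i x)) - φ j (homAt g j (E.arrowMap a x)) := by
    intro i j a x
    obtain ⟨y, hy⟩ := ((hex i).2.2 (x - s i (homAt g i x))).1 (by simp [hs'])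
    have hx : x = homAt f i y + s i (homAt g i x) := by
      rw [show homAt f i y = _ from hy]; abel
    rw [homAt_arrowMap, ← hφ]
    generalize homAt g i x = z at hx
    subst hx
    simp [← homAt_arrowMap, hr']
  refine ⟨mkHom (fun i => r i + φ i ∘ₗ homAt g i) fun i j a x => ?_, ?_⟩
  · have := key i j a x
    simp only [LinearMap.add_apply, LinearMap.comp_apply, map_add]
    rw [sub_eq_sub_iff_add_eq_add] at this
    rw [this, add_comm]
  · refine hom_ext fun i x => ?_
    simp [hr', hfg]

end Splitting

/-! ### Thin representations and idempotent endomorphisms -/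

section Thin

variable {k : Type u} [Field k] {V : Type w} {Q : Quiver.{v} V}

open Classical in
/-- The coordinate on a space of functions on a proposition, which is `0` if the proposition
fails. -/
def thinCoord (k : Type u) [Field k] (p : Prop) : (PLift p → k) →ₗ[k] k :=
  if h : p then LinearMap.proj ⟨h⟩ else 0

/-- The constant function on a proposition. -/
def thinConst (k : Type u) [Field k] (p : Prop) : k →ₗ[k] (PLift p → k) :=
  LinearMap.pi fun _ => LinearMap.id

open Classical in
lemma thinCoord_thinConst (p : Prop) (c : k) :
    thinCoord k p (thinConst k p c) = if p then c else 0 := by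
  unfold thinCoord
  split_ifs <;> simp [thinConst]

lemma thinConst_thinCoord (p : Prop) (x : PLift p → k) :
    thinConst k p (thinCoord k p x) = x := by
  funext h
  simp [thinCoord, thinConst, h.down]

lemma thinCoord_injective (p : Prop) : Function.Injective (thinCoord k p) :=
  Function.LeftInverse.injective (thinConst_thinCoord p)

lemma thinCoord_of_not {p : Prop} (hp : ¬p) (x : PLift p → k) : thinCoord k p x = 0 := by
  simp [thinCoord, hp]

open Classical in
lemma finrank_thin (p : Prop) : Module.finrank k (PLift p → k) = if p then 1 else 0 := by
  by_cases h : p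
  · have : Unique (PLift p) := ⟨⟨⟨h⟩⟩, fun _ => Subsingleton.elim _ _⟩
    simp [h]
  · have : IsEmpty (PLift p) := ⟨fun x => h x.down⟩
    simp [h]

variable (k Q) in
/-- The thin representation on a set of vertices: one-dimensional at these vertices, zero
elsewhere, with identities along the arrows between them. -/
def thinRep (I : Set V) : QRep k Q :=
  Paths.lift
    { obj := fun i => ModuleCat.of k (PLift (i ∈ I) → k)
      map := fun {i j} _ => ModuleCat.ofHom (thinConst k (j ∈ I) ∘ₗ thinCoord k (i ∈ I)) }

/-- The coordinate of a thin representation at a vertex. -/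
def coordAt (I : Set V) (i : V) : (thinRep k Q I).space i →ₗ[k] k := thinCoord k (i ∈ I)

/-- The element of a thin representation at a vertex with given coordinate. -/
def constAt (I : Set V) (i : V) : k →ₗ[k] (thinRep k Q I).space i := thinConst k (i ∈ I)

lemma thinRep_arrowMap (I : Set V) {i j : V} (f : Q.Hom i j) (x : (thinRep k Q I).space i) :
    (thinRep k Q I).arrowMap f x = constAt I j (coordAt I i x) := by
  unfold QRep.arrowMap thinRep
  erw [Paths.lift_toPath]
  rfl

open Classical in
lemma coordAt_constAt (I : Set V) (i : V) (c : k) :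
    coordAt (Q := Q) I i (constAt I i c) = if i ∈ I then c else 0 := thinCoord_thinConst _ c

lemma coordAt_constAt_of_mem {I : Set V} {i : V} (hi : i ∈ I) (c : k) :
    coordAt (Q := Q) I i (constAt I i c) = c := by
  rw [coordAt_constAt, if_pos hi]

lemma constAt_coordAt (I : Set V) (i : V) (x : (thinRep k Q I).space i) :
    constAt I i (coordAt I i x) = x := thinConst_thinCoord _ x

lemma coordAt_injective (I : Set V) (i : V) :
    Function.Injective (coordAt (k := k) (Q := Q) I i) := thinCoord_injective _

lemma coordAt_of_notMem {I : Set V} {i : V} (hi : i ∉ I) (x : (thinRep k Q I).space i) :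
    coordAt I i x = 0 := thinCoord_of_not hi x

open Classical in
lemma dimVec_thinRep (I : Set V) (i : V) :
    dimVec (thinRep k Q I) i = if i ∈ I then 1 else 0 := finrank_thin _

lemma isFinDim_thinRep (I : Set V) : IsFinDim (thinRep k Q I) := fun i =>
  FiniteDimensional.of_injective (coordAt I i) (coordAt_injective I i)

lemma dimVec_eq_of_iso {M N : QRep k Q} (e : M ≅ N) : dimVec M = dimVec N :=
  funext fun i => (e.app ((Paths.of V).obj i)).toLinearEquiv.finrank_eq

lemma isFinDim_of_iso {M N : QRep k Q} (e : M ≅ N) (h : IsFinDim M) : IsFinDim N := fun i =>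
  have := h i
  Module.Finite.equiv (e.app ((Paths.of V).obj i)).toLinearEquiv

/-- Maps between spaces of dimension at most one are scalars. A cochain is thus a number on each
arrow from I to J, and the correcting maps are numbers on I ∩ J. -/
lemma subsingleton_ext_one_thinRep [HasExt.{v'} (QRep k Q)] {I J : Set V}
    (H : ∀ c : (∀ i j : V, Q.Hom i j → k), ∃ e : V → k, (∀ i, ¬(i ∈ I ∧ i ∈ J) → e i = 0) ∧
      ∀ (i j : V) (f : Q.Hom i j), i ∈ I → j ∈ J → c i j f = e i - e j) :
    Subsingleton (Abelian.Ext (thinRep k Q I) (thinRep k Q J) 1) := by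
  refine QRep.subsingleton_ext_one fun h => ?_
  obtain ⟨e, he0, he⟩ := H fun i j f => coordAt J j (h i j f (constAt I i 1))
  refine ⟨fun i => constAt J i ∘ₗ (e i • coordAt I i), fun i j f x => ?_⟩
  apply coordAt_injective
  by_cases hj : j ∈ J
  · by_cases hi : i ∈ I
    · have hx : x = coordAt I i x • constAt I i 1 := by
        rw [← map_smul, smul_eq_mul, mul_one, constAt_coordAt]
      generalize coordAt I i x = y at hx
      subst hx
      simp only [map_smul, LinearMap.comp_apply, LinearMap.smul_apply, smul_eq_mul,
        map_sub, thinRep_arrowMap, coordAt_constAt, hi, hj, if_true, he i j f hi hj]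
      have h1 : i ∉ J → e i = 0 := fun h => he0 i fun h' => h h'.2
      have h2 : j ∉ I → e j = 0 := fun h => he0 j fun h' => h h'.1
      split_ifs with h3 h4 h4
      · ring
      · rw [h2 h4]; ring
      · rw [h1 h3]; ring
      · rw [h1 h3, h2 h4]; ring
    · have hx : x = 0 := coordAt_injective I i (by rw [coordAt_of_notMem hi, map_zero])
      simp [hx]
  · rw [coordAt_of_notMem hj, coordAt_of_notMem hj]

/-- An object is indecomposable if its only idempotent endomorphisms are `0` and `1`. -/
lemma indecomposable_of_idempotents {C : Type*} [Category C] [Preadditive C]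
    [HasBinaryBiproducts C] {X : C} (hX : ¬IsZero X)
    (h : ∀ e : X ⟶ X, e ≫ e = e → e = 0 ∨ e = 𝟙 X) : Indecomposable X := by
  refine ⟨hX, fun Y Z α => ?_⟩
  rcases h (α.hom ≫ biprod.fst ≫ biprod.inl ≫ α.inv) (by simp) with he | he
  · left
    rw [IsZero.iff_id_eq_zero]
    have : (biprod.inl : Y ⟶ Y ⊞ Z) ≫ α.inv ≫ (α.hom ≫ biprod.fst ≫ biprod.inl ≫ α.inv) ≫
        α.hom ≫ biprod.fst = 0 := by rw [he]; simp
    simpa using this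
  · right
    rw [IsZero.iff_id_eq_zero]
    have : (biprod.inr : Z ⟶ Y ⊞ Z) ≫ α.inv ≫ (α.hom ≫ biprod.fst ≫ biprod.inl ≫ α.inv) ≫
        α.hom ≫ biprod.snd = 𝟙 Z := by rw [he]; simp
    simpa using this.symm

end Thin

/-! ### Extensions and endomorphisms of interval representations -/

section Linear

/-- A quiver with vertices at distinct positions on a line, arrows only between consecutive
positions, and exactly one arrow between vertices at consecutive positions `t` and `t + 1`,
pointing upwards if and only if `o t`. -/
structure IsLinear {V : Type w} (Q : Quiver.{v} V) (pos : V → ℕ) (o : ℕ → Prop) : Prop where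
  injective : Function.Injective pos
  subsingleton : ∀ i j, Subsingleton (Q.Hom i j)
  hom : ∀ i j, Q.Hom i j →
    (pos i + 1 = pos j ∧ o (pos i)) ∨ (pos j + 1 = pos i ∧ ¬o (pos j))
  up : ∀ i j, pos i + 1 = pos j → o (pos i) → Nonempty (Q.Hom i j)
  down : ∀ i j, pos i + 1 = pos j → ¬o (pos i) → Nonempty (Q.Hom j i)

/-- The left ends of two intervals exclude a morphism from the first to the second. -/
def LeftBlock (o : ℕ → Prop) (a c : ℕ) : Prop := (a < c ∧ o (c - 1)) ∨ (c < a ∧ ¬o (a - 1))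

/-- The right ends of two intervals exclude a morphism from the first to the second. -/
def RightBlock (o : ℕ → Prop) (b d : ℕ) : Prop := (b < d ∧ o b) ∨ (d < b ∧ ¬o d)

/-- The combinatorial condition on intervals for the vanishing of extensions. -/
def ExtVanish (o : ℕ → Prop) (I J : ℕ × ℕ) : Prop :=
  I.2 + 1 ≠ J.1 ∧ J.2 + 1 ≠ I.1 ∧
    (I.1 ≤ J.2 → J.1 ≤ I.2 → ¬(LeftBlock o I.1 J.1 ∧ RightBlock o I.2 J.2))

variable {k : Type u} [Field k] {V : Type w} {Q : Quiver.{v} V} {pos : V → ℕ} {o : ℕ → Prop}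

/-- The set of vertices with position in a given interval. -/
def posIcc (pos : V → ℕ) (I : ℕ × ℕ) : Set V := {i | I.1 ≤ pos i ∧ pos i ≤ I.2}

/-- With the sign given by the direction of the arrow, the coboundary equation on either kind of
edge becomes the single recursion e t - e (t + 1) = η t. -/
lemma IsLinear.exists_signed (hQ : IsLinear Q pos o) (c : ∀ i j : V, Q.Hom i j → k) :
    ∃ η : ℕ → k, ∀ (i j : V) (f : Q.Hom i j),
      (pos i + 1 = pos j → η (pos i) = c i j f) ∧
      (pos j + 1 = pos i → η (pos j) = -c i j f) := by
  have : ∀ t : ℕ, ∃ y : k, ∀ (i j : V) (f : Q.Hom i j),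
      (pos i = t → pos j = t + 1 → y = c i j f) ∧
      (pos i = t + 1 → pos j = t → y = -c i j f) := by
    intro t
    by_cases h : ∃ i j : V, Nonempty (Q.Hom i j) ∧
      ((pos i = t ∧ pos j = t + 1) ∨ (pos i = t + 1 ∧ pos j = t))
    · obtain ⟨i, j, ⟨f⟩, h⟩ := h
      refine ⟨if pos i = t then c i j f else -c i j f, fun i' j' f' => ?_⟩
      have h1 := hQ.hom _ _ f
      have h2 := hQ.hom _ _ f'
      constructor
      · intro hi hj
        rcases h with h | h
        · obtain rfl := hQ.injective (hi.trans h.1.symm)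
          obtain rfl := hQ.injective (hj.trans h.2.symm)
          rw [if_pos h.1, (hQ.subsingleton _ _).elim f f']
        · exfalso
          rw [hi, hj] at h2
          rw [h.1, h.2] at h1
          grind
      · intro hi hj
        rcases h with h | h
        · exfalso
          rw [hi, hj] at h2
          rw [h.1, h.2] at h1
          grind
        · obtain rfl := hQ.injective (hi.trans h.1.symm)
          obtain rfl := hQ.injective (hj.trans h.2.symm)
          rw [if_neg (by omega), (hQ.subsingleton _ _).elim f f']
    · exact ⟨0, fun i j f => ⟨fun hi hj => (h ⟨i, j, ⟨f⟩, Or.inl ⟨hi, hj⟩⟩).elim,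
        fun hi hj => (h ⟨i, j, ⟨f⟩, Or.inr ⟨hi, hj⟩⟩).elim⟩⟩
  choose η hη using this
  exact ⟨η, fun i j f => ⟨fun h => (hη _ i j f).1 rfl h.symm, fun h => (hη _ i j f).2 h.symm rfl⟩⟩

/-- Inside the intersection the recursion determines e up to one constant. The equation at an end of
the intersection is imposed only if the arrow there leads from I to J, which is what the block
conditions express. They do not hold at both ends, so one constant suffices. If the intersection is
empty, non-adjacency leaves no equation. -/
lemma IsLinear.subsingleton_ext_one [HasExt.{v'} (QRep k Q)] (hQ : IsLinear Q pos o)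
    {I J : ℕ × ℕ} (h : ExtVanish o I J) :
    Subsingleton (Abelian.Ext (thinRep k Q (posIcc pos I)) (thinRep k Q (posIcc pos J)) 1) := by
  classical
  refine subsingleton_ext_one_thinRep fun c => ?_
  obtain ⟨η, hη⟩ := hQ.exists_signed c
  obtain ⟨a, b⟩ := I
  obtain ⟨p, q⟩ := J
  obtain ⟨h1, h2, h3⟩ := h
  simp only at h1 h2 h3
  let H : ℕ → k := fun t => ∑ s ∈ Finset.range t, η s
  have hH : ∀ t, H (t + 1) = H t + η t := fun t => Finset.sum_range_succ _ _
  -- The first value makes e vanish just left of the intersection, the second just right of it, in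
  -- agreement with the recursion.
  let C : k := if LeftBlock o a p then H (max a p - 1) else H (min b q + 1)
  let e : ℕ → k := fun t => if (a ≤ t ∧ t ≤ b) ∧ (p ≤ t ∧ t ≤ q) then C - H t else 0
  have he : ∀ t, e t - e (t + 1) ≠ η t →
      (o t → ¬((a ≤ t ∧ t ≤ b) ∧ (p ≤ t + 1 ∧ t + 1 ≤ q))) ∧
      (¬o t → ¬((a ≤ t + 1 ∧ t + 1 ≤ b) ∧ (p ≤ t ∧ t ≤ q))) := by
    intro t hne
    by_cases ht : (a ≤ t ∧ t ≤ b) ∧ (p ≤ t ∧ t ≤ q)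
    · by_cases ht' : (a ≤ t + 1 ∧ t + 1 ≤ b) ∧ (p ≤ t + 1 ∧ t + 1 ≤ q)
      · exact (hne (by simp only [e, if_pos ht, if_pos ht', hH]; ring)).elim
      · have hb : RightBlock o b q → e t - e (t + 1) = η t := fun hb => by
          have hC : C = H (min b q + 1) := if_neg fun hl => h3 (by omega) (by omega) ⟨hl, hb⟩
          have : min b q = t := by omega
          simp only [e, if_pos ht, if_neg ht', hC, this, hH]; ring
        constructor
        · intro ho hin
          have : b = t := by omega
          exact hne (hb (Or.inl ⟨by omega, this ▸ ho⟩))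
        · intro ho hin
          have : q = t := by omega
          exact hne (hb (Or.inr ⟨by omega, this ▸ ho⟩))
    · by_cases ht' : (a ≤ t + 1 ∧ t + 1 ≤ b) ∧ (p ≤ t + 1 ∧ t + 1 ≤ q)
      · have hb : LeftBlock o a p → e t - e (t + 1) = η t := fun hb => by
          have hC : C = H (max a p - 1) := if_pos hb
          have : max a p - 1 = t := by omega
          simp only [e, if_neg ht, if_pos ht', hC, this, hH]; ring
        constructor
        · intro ho hin
          have : p - 1 = t := by omega
          exact hne (hb (Or.inl ⟨by omega, this ▸ ho⟩))
        · intro ho hin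
          have : a - 1 = t := by omega
          exact hne (hb (Or.inr ⟨by omega, this ▸ ho⟩))
      · constructor <;> intro ho hin <;> omega
  refine ⟨fun i => e (pos i), fun i hi => if_neg hi, fun i j f hi hj => ?_⟩
  change a ≤ pos i ∧ pos i ≤ b at hi
  change p ≤ pos j ∧ pos j ≤ q at hj
  by_contra hne
  rcases hQ.hom i j f with ⟨hp, ho⟩ | ⟨hp, ho⟩
  · refine (he (pos i) ?_).1 ho ⟨hi, by rw [hp]; exact hj⟩
    rw [(hη i j f).1 hp, hp]
    exact Ne.symm hne
  · refine (he (pos j) ?_).2 ho ⟨by rw [hp]; exact hi, hj⟩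
    rw [(hη i j f).2 hp, hp]
    intro h'
    apply hne
    simp only
    linear_combination h'

/-- An arrow inside the interval equates the scalars at its two ends. The hypothesis `hV` keeps the
interval connected, as vertices of a full subquiver may leave gaps. -/
lemma IsLinear.exists_scalar (hQ : IsLinear Q pos o) {I : ℕ × ℕ}
    (hV : ∀ t, I.1 ≤ t → t ≤ I.2 → ∃ i, pos i = t)
    (e : thinRep k Q (posIcc pos I) ⟶ thinRep k Q (posIcc pos I)) :
    ∃ c : k, ∀ i x, coordAt (posIcc pos I) i (QRep.homAt e i x) =
        c * coordAt (posIcc pos I) i x := by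
  obtain ⟨a, b⟩ := I
  let s : V → k := fun i => coordAt _ i (QRep.homAt e i (constAt _ i 1))
  have hs : ∀ i x, coordAt (posIcc pos (a, b)) i (QRep.homAt e i x) =
      s i * coordAt (posIcc pos (a, b)) i x := by
    intro i x
    conv_lhs => rw [← constAt_coordAt _ i x, ← mul_one (coordAt _ i x), ← smul_eq_mul, map_smul,
      map_smul, map_smul, smul_eq_mul, mul_comm]
  have hnat : ∀ i j, Q.Hom i j → i ∈ posIcc pos (a, b) → j ∈ posIcc pos (a, b) → s j = s i := by
    intro i j f hi hj
    have := congrArg (coordAt _ j) (QRep.homAt_arrowMap e f (constAt _ i 1))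
    rw [hs, thinRep_arrowMap, thinRep_arrowMap, hs, coordAt_constAt_of_mem hj,
      coordAt_constAt_of_mem hj, coordAt_constAt_of_mem hi] at this
    simpa using this
  have hconst : ∃ c, ∀ t, a ≤ t → t ≤ b → ∀ i, pos i = t → s i = c := by
    by_cases hab : a ≤ b
    · obtain ⟨i₀, hi₀⟩ := hV a le_rfl hab
      refine ⟨s i₀, fun t hat => ?_⟩
      induction t, hat using Nat.le_induction with
      | base => intro _ i hi; rw [hQ.injective (hi.trans hi₀.symm)]
      | succ t hat ih =>
        intro htb i hi
        obtain ⟨j, hj⟩ := hV t hat (Nat.le_of_succ_le htb)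
        rw [← ih (Nat.le_of_succ_le htb) j hj]
        have hi' : i ∈ posIcc pos (a, b) := ⟨show a ≤ pos i by omega, show pos i ≤ b by omega⟩
        have hj' : j ∈ posIcc pos (a, b) := ⟨show a ≤ pos j by omega, show pos j ≤ b by omega⟩
        by_cases ho : o (pos j)
        · obtain ⟨f⟩ := hQ.up j i (by omega) ho
          exact hnat _ _ f hj' hi'
        · obtain ⟨f⟩ := hQ.down j i (by omega) ho
          exact (hnat _ _ f hi' hj').symm
    · exact ⟨0, fun t h1 h2 => (hab (h1.trans h2)).elim⟩
  obtain ⟨c, hc⟩ := hconst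
  refine ⟨c, fun i x => ?_⟩
  by_cases hi : i ∈ posIcc pos (a, b)
  · rw [hs, hc _ hi.1 hi.2 i rfl]
  · rw [coordAt_of_notMem hi, coordAt_of_notMem hi, mul_zero]

lemma not_isZero_thinRep {I : Set V} {i : V} (hi : i ∈ I) : ¬IsZero (thinRep k Q I) := by
  intro h0
  have := congrArg (fun φ => coordAt _ i (QRep.homAt φ i (constAt _ i 1)))
    ((IsZero.iff_id_eq_zero _).1 h0)
  simp [coordAt_constAt_of_mem hi] at this

lemma IsLinear.indecomposable_thinRep (hQ : IsLinear Q pos o) {I : ℕ × ℕ} (hI : I.1 ≤ I.2)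
    (hV : ∀ t, I.1 ≤ t → t ≤ I.2 → ∃ i, pos i = t) :
    Indecomposable (thinRep k Q (posIcc pos I)) := by
  obtain ⟨i, hi⟩ := hV _ le_rfl hI
  have hmem : i ∈ posIcc pos I := ⟨hi.ge, hi.trans_le hI⟩
  refine indecomposable_of_idempotents (not_isZero_thinRep hmem) fun e he => ?_
  obtain ⟨c, hc⟩ := hQ.exists_scalar hV e
  have hidem : c * c = c := by
    have := congrArg (fun φ => coordAt _ i (QRep.homAt φ i (constAt _ i 1))) he
    simpa only [QRep.homAt_comp, hc, coordAt_constAt_of_mem hmem, mul_one] using this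
  rcases IsIdempotentElem.iff_eq_zero_or_one.1 hidem with rfl | rfl
  · left
    refine QRep.hom_ext fun i x => coordAt_injective _ _ ?_
    rw [hc, zero_mul, QRep.homAt_zero, map_zero]
  · right
    refine QRep.hom_ext fun i x => coordAt_injective _ _ ?_
    rw [hc, one_mul, QRep.homAt_id]

end Linear

/-! ### Retracts and direct summands -/

section Summands

/-- A retract in an abelian category is a direct summand. -/
lemma exists_iso_biprod_of_retraction {C : Type*} [Category C] [Abelian C] {X Y : C}
    (f : X ⟶ Y) (r : Y ⟶ X) (h : f ≫ r = 𝟙 X) : ∃ Z : C, Nonempty (Y ≅ X ⊞ Z) := by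
  have : IsSplitMono f := ⟨⟨⟨r, h⟩⟩⟩
  exact ⟨_, ⟨biprod.uniqueUpToIso _ _
    (isBilimitBinaryBiconeOfIsSplitMonoOfCokernel (cokernelIsCokernel f))⟩⟩

/-- A nonzero retract of an indecomposable object is isomorphic to it. -/
lemma nonempty_iso_of_retraction {C : Type*} [Category C] [Abelian C] {X Y : C}
    (hY : Indecomposable Y) (hX : ¬IsZero X) (f : X ⟶ Y) (r : Y ⟶ X) (h : f ≫ r = 𝟙 X) :
    Nonempty (Y ≅ X) := by
  obtain ⟨Z, ⟨e⟩⟩ := exists_iso_biprod_of_retraction f r h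
  have hZ := (hY.2 X Z e).resolve_left hX
  exact ⟨e ≪≫ (isoBiprodZero hZ).symm⟩

end Summands

/-! ### Gabriel's theorem in type A, by filtrations along the line -/

section Gabriel

variable {k : Type u} [Field k] {n : ℕ} {Q : Quiver.{v} (Fin n)} {o : ℕ → Prop}

/-- A family of vectors, one for each vertex, which vanishes off `[a, m]` and is compatible with
the arrows between vertices up to `m` that start at a vertex not below `a`. -/
def IsVectorStrip (N : QRep k Q) (a m : ℕ) (w : ∀ i, N.space i) : Prop :=
  (∀ i : Fin n, ¬(a ≤ (i : ℕ) ∧ (i : ℕ) ≤ m) → w i = 0) ∧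
    ∀ (i j : Fin n) (f : Q.Hom i j), (i : ℕ) ≤ m → (j : ℕ) ≤ m → a ≤ (i : ℕ) →
      N.arrowMap f (w i) = w j

/-- A family of linear forms, one for each vertex, which vanishes off `[a, m]` and is compatible
with the arrows between vertices up to `m` that end at a vertex not below `a`. -/
def IsCovectorStrip (N : QRep k Q) (a m : ℕ) (ζ : ∀ i, N.space i →ₗ[k] k) : Prop :=
  (∀ i : Fin n, ¬(a ≤ (i : ℕ) ∧ (i : ℕ) ≤ m) → ζ i = 0) ∧
    ∀ (i j : Fin n) (f : Q.Hom i j), (i : ℕ) ≤ m → (j : ℕ) ≤ m → a ≤ (j : ℕ) →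
      ζ j ∘ₗ N.arrowMap f = ζ i

/-- Between the subspaces `A` and `B` at the vertex `m`, every vector extends to a compatible
family of vectors, and every linear form to a compatible family of linear forms, on the same
interval `[a, m]`. -/
def IsStrip (N : QRep k Q) (m : Fin n) (A B : Submodule k (N.space m)) : Prop :=
  ∃ a ≤ (m : ℕ), (∀ v ∈ B, ∃ w, w m = v ∧ IsVectorStrip N a m w) ∧
    ∀ ξ : N.space m →ₗ[k] k, A ≤ LinearMap.ker ξ → ∃ ζ, ζ m = ξ ∧ IsCovectorStrip N a m ζ

lemma IsVectorStrip.extend (hQ : IsLinear Q Fin.val o) {N : QRep k Q} {a : ℕ} {m m' : Fin n}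
    (hm : (m : ℕ) + 1 = m') {w : ∀ i, N.space i} (hw : IsVectorStrip N a m w)
    (ha : a ≤ (m' : ℕ)) {v : N.space m'}
    (h1 : ∀ f : Q.Hom m m', a ≤ (m : ℕ) → N.arrowMap f (w m) = v)
    (h2 : ∀ f : Q.Hom m' m, N.arrowMap f v = w m) :
    ∃ w', w' m' = v ∧ IsVectorStrip N a m' w' := by
  refine ⟨Function.update w m' v, Function.update_self _ _ _, fun i hi => ?_,
    fun i j f hi hj hai => ?_⟩
  · have : i ≠ m' := by rintro rfl; exact hi ⟨ha, le_rfl⟩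
    rw [Function.update_of_ne this]
    exact hw.1 i (by omega)
  · have hadj := hQ.hom i j f
    by_cases him : i = m'
    · subst him
      have hjm : j = m := Fin.ext (by omega)
      subst hjm
      rw [Function.update_self, Function.update_of_ne (by rintro rfl; omega)]
      exact h2 f
    · have hi' : (i : ℕ) ≤ m := by
        have : (i : ℕ) ≠ m' := fun h => him (Fin.ext h)
        omega
      rw [Function.update_of_ne him]
      by_cases hjm : j = m'
      · subst hjm
        have : i = m := Fin.ext (by omega)
        subst this
        rw [Function.update_self]
        exact h1 f hai
      · have hj' : (j : ℕ) ≤ m := by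
          have : (j : ℕ) ≠ m' := fun h => hjm (Fin.ext h)
          omega
        rw [Function.update_of_ne hjm]
        exact hw.2 i j f hi' hj' hai

lemma IsCovectorStrip.extend (hQ : IsLinear Q Fin.val o) {N : QRep k Q} {a : ℕ} {m m' : Fin n}
    (hm : (m : ℕ) + 1 = m') {ζ : ∀ i, N.space i →ₗ[k] k} (hw : IsCovectorStrip N a m ζ)
    (ha : a ≤ (m' : ℕ)) {ξ : N.space m' →ₗ[k] k}
    (h1 : ∀ f : Q.Hom m m', ξ ∘ₗ N.arrowMap f = ζ m)
    (h2 : ∀ f : Q.Hom m' m, a ≤ (m : ℕ) → ζ m ∘ₗ N.arrowMap f = ξ) :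
    ∃ ζ', ζ' m' = ξ ∧ IsCovectorStrip N a m' ζ' := by
  refine ⟨Function.update ζ m' ξ, Function.update_self _ _ _, fun i hi => ?_,
    fun i j f hi hj haj => ?_⟩
  · have : i ≠ m' := by rintro rfl; exact hi ⟨ha, le_rfl⟩
    rw [Function.update_of_ne this]
    exact hw.1 i (by omega)
  · have hadj := hQ.hom i j f
    by_cases him : i = m'
    · subst him
      have hjm : j = m := Fin.ext (by omega)
      subst hjm
      rw [Function.update_self, Function.update_of_ne (by rintro rfl; omega)]
      exact h2 f haj
    · have hi' : (i : ℕ) ≤ m := by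
        have : (i : ℕ) ≠ m' := fun h => him (Fin.ext h)
        omega
      rw [Function.update_of_ne him]
      by_cases hjm : j = m'
      · subst hjm
        have : i = m := Fin.ext (by omega)
        subst this
        rw [Function.update_self]
        exact h1 f
      · have hj' : (j : ℕ) ≤ m := by
          have : (j : ℕ) ≠ m' := fun h => hjm (Fin.ext h)
          omega
        rw [Function.update_of_ne hjm]
        exact hw.2 i j f hi' hj' haj

lemma isVectorStrip_zero (N : QRep k Q) (a m : ℕ) : IsVectorStrip N a m fun _ => 0 :=
  ⟨fun _ _ => rfl, fun _ _ _ _ _ _ => map_zero _⟩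

lemma isCovectorStrip_zero (N : QRep k Q) (a m : ℕ) : IsCovectorStrip N a m fun _ => 0 :=
  ⟨fun _ _ => rfl, fun _ _ _ _ _ _ => LinearMap.zero_comp _⟩

lemma IsStrip.map (hQ : IsLinear Q Fin.val o) {N : QRep k Q} {m m' : Fin n}
    (hm : (m : ℕ) + 1 = m') (f : Q.Hom m m') {A B : Submodule k (N.space m)}
    (h : IsStrip N m A B) : IsStrip N m' (A.map (N.arrowMap f)) (B.map (N.arrowMap f)) := by
  have hno : ∀ f' : Q.Hom m' m, False := fun f' => by
    have h1 := hQ.hom _ _ f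
    have h2 := hQ.hom _ _ f'
    grind
  have huniq : ∀ f' : Q.Hom m m', f' = f := fun f' => (hQ.subsingleton _ _).elim _ _
  obtain ⟨a, ha, hB, hA⟩ := h
  refine ⟨a, by omega, ?_, fun ξ hξ => ?_⟩
  · rintro _ ⟨v, hv, rfl⟩
    obtain ⟨w, rfl, hw⟩ := hB v hv
    exact hw.extend hQ hm (by omega) (fun f' _ => by rw [huniq f']) fun f' => (hno f').elim
  · obtain ⟨ζ, hζ, hs⟩ := hA (ξ ∘ₗ N.arrowMap f) fun x hx => hξ (Submodule.mem_map_of_mem hx)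
    exact hs.extend hQ hm (by omega) (fun f' => by rw [huniq f', hζ]) fun f' => (hno f').elim

lemma IsStrip.comap (hQ : IsLinear Q Fin.val o) {N : QRep k Q} {m m' : Fin n}
    (hm : (m : ℕ) + 1 = m') (f : Q.Hom m' m) {A B : Submodule k (N.space m)}
    (h : IsStrip N m A B) : IsStrip N m' (A.comap (N.arrowMap f)) (B.comap (N.arrowMap f)) := by
  have hno : ∀ f' : Q.Hom m m', False := fun f' => by
    have h1 := hQ.hom _ _ f
    have h2 := hQ.hom _ _ f'
    grind
  have huniq : ∀ f' : Q.Hom m' m, f' = f := fun f' => (hQ.subsingleton _ _).elim _ _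
  obtain ⟨a, ha, hB, hA⟩ := h
  refine ⟨a, by omega, fun v hv => ?_, fun ξ hξ => ?_⟩
  · obtain ⟨w, h1, hw⟩ := hB _ hv
    exact hw.extend hQ hm (by omega) (fun f' => (hno f').elim) fun f' => by rw [huniq f', h1]
  -- A form that kills the preimage of A factors through the injection of the quotient by this
  -- preimage into N_m / A, and extends from there to a form ξ' on N_m / A.
  · have : ξ ∈ LinearMap.range (A.mkQ ∘ₗ N.arrowMap f).dualMap := by
      rw [LinearMap.range_dualMap_eq_dualAnnihilator_ker, Submodule.mem_dualAnnihilator]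
      intro x hx
      refine hξ ?_
      simpa using hx
    obtain ⟨ξ', rfl⟩ := this
    obtain ⟨ζ, hζ, hs⟩ := hA (ξ' ∘ₗ A.mkQ) fun x hx => by
      rw [LinearMap.mem_ker, LinearMap.comp_apply, Submodule.mkQ_apply,
        (Submodule.Quotient.mk_eq_zero A).2 hx, map_zero]
    refine hs.extend hQ hm (by omega) (fun f' => (hno f').elim) fun f' _ => ?_
    rw [huniq f', hζ]
    rfl

/-- This is the interval starting at the new vertex. The incoming arrow restricts no vector placed
there, but a form supported there has to kill its image. -/
lemma isStrip_range_top (hQ : IsLinear Q Fin.val o) (N : QRep k Q) {m m' : Fin n}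
    (hm : (m : ℕ) + 1 = m') (f : Q.Hom m m') :
    IsStrip N m' (LinearMap.range (N.arrowMap f)) ⊤ := by
  have hno : ∀ f' : Q.Hom m' m, False := fun f' => by
    have h1 := hQ.hom _ _ f
    have h2 := hQ.hom _ _ f'
    grind
  have huniq : ∀ f' : Q.Hom m m', f' = f := fun f' => (hQ.subsingleton _ _).elim _ _
  refine ⟨m', le_rfl, fun v _ => ?_, fun ξ hξ => ?_⟩
  · exact (isVectorStrip_zero N m' m).extend hQ hm le_rfl (fun _ h => by omega)
      fun f' => (hno f').elim
  · refine (isCovectorStrip_zero N m' m).extend hQ hm le_rfl (fun f' => ?_)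
      fun f' => (hno f').elim
    rw [huniq f', ← LinearMap.range_le_ker_iff]
    exact hξ

/-- Dual to `isStrip_range_top`: the outgoing arrow has to kill the vector and restricts no form. -/
lemma isStrip_bot_ker (hQ : IsLinear Q Fin.val o) (N : QRep k Q) {m m' : Fin n}
    (hm : (m : ℕ) + 1 = m') (f : Q.Hom m' m) :
    IsStrip N m' ⊥ (LinearMap.ker (N.arrowMap f)) := by
  have hno : ∀ f' : Q.Hom m m', False := fun f' => by
    have h1 := hQ.hom _ _ f
    have h2 := hQ.hom _ _ f'
    grind
  have huniq : ∀ f' : Q.Hom m' m, f' = f := fun f' => (hQ.subsingleton _ _).elim _ _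
  refine ⟨m', le_rfl, fun v hv => ?_, fun ξ _ => ?_⟩
  · refine (isVectorStrip_zero N m' m).extend hQ hm le_rfl (fun f' => (hno f').elim)
      fun f' => ?_
    rw [huniq f']
    exact hv
  · exact (isCovectorStrip_zero N m' m).extend hQ hm le_rfl (fun f' => (hno f').elim)
      fun f' h => by omega

/-- This is the functorial filtration at a vertex. The chain is transported to the next vertex by
images or preimages, according to the arrow; the missing step from the image to ⊤, or from ⊥ to the
kernel, comes from intervals that start at the new vertex. -/
lemma reflTransGen_isStrip (hQ : IsLinear Q Fin.val o) (N : QRep k Q) :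
    ∀ (t : ℕ) (ht : t < n), Relation.ReflTransGen (IsStrip N ⟨t, ht⟩) ⊥ ⊤ := by
  intro t
  induction t with
  | zero =>
    intro ht
    refine Relation.ReflTransGen.single ⟨0, le_rfl, fun v _ => ?_, fun ξ _ => ?_⟩
    · refine ⟨Function.update (fun _ => 0) ⟨0, ht⟩ v, Function.update_self _ _ _,
        fun i hi => Function.update_of_ne (by rintro rfl; simp at hi) _ _,
        fun i j f hi hj => ?_⟩
      have := hQ.hom i j f
      simp only at hi hj
      omega
    · refine ⟨Function.update (fun _ => 0) ⟨0, ht⟩ ξ, Function.update_self _ _ _,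
        fun i hi => Function.update_of_ne (by rintro rfl; simp at hi) _ _,
        fun i j f hi hj => ?_⟩
      have := hQ.hom i j f
      simp only at hi hj
      omega
  | succ t ih =>
    intro ht
    have ih := ih (by omega)
    have hm : ((⟨t, by omega⟩ : Fin n) : ℕ) + 1 = (⟨t + 1, ht⟩ : Fin n) := rfl
    by_cases ho : o t
    · obtain ⟨f⟩ := hQ.up ⟨t, by omega⟩ ⟨t + 1, ht⟩ rfl ho
      have h := Relation.ReflTransGen.lift (Submodule.map (N.arrowMap f))
        (fun _ _ h => IsStrip.map hQ hm f h) _ _ ih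
      rw [Function.onFun, Submodule.map_bot, Submodule.map_top] at h
      exact h.tail (isStrip_range_top hQ N hm f)
    · obtain ⟨f⟩ := hQ.down ⟨t, by omega⟩ ⟨t + 1, ht⟩ rfl ho
      have h := Relation.ReflTransGen.lift (Submodule.comap (N.arrowMap f))
        (fun _ _ h => IsStrip.comap hQ hm f h) _ _ ih
      rw [Function.onFun, Submodule.comap_bot, Submodule.comap_top] at h
      exact (Relation.ReflTransGen.single (isStrip_bot_ker hQ N hm f)).trans h

/-- Gabriel's theorem in type `A`: an indecomposable representation is the thin representation of
an interval. -/
lemma exists_iso_thinRep (hQ : IsLinear Q Fin.val o) {N : QRep k Q} (hN : Indecomposable N) :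
    ∃ (a : ℕ) (m : Fin n), a ≤ (m : ℕ) ∧
      Nonempty (N ≅ thinRep k Q (posIcc Fin.val (a, (m : ℕ)))) := by
  have hne : ∃ i, Nontrivial (N.space i) := by
    by_contra! h
    apply hN.1
    rw [IsZero.iff_id_eq_zero]
    exact QRep.hom_ext fun i x => (h i).elim _ _
  -- At the last vertex of the support no arrow to the right can obstruct the morphisms built from
  -- strips.
  obtain ⟨m, hm, hmax⟩ : ∃ m, Nontrivial (N.space m) ∧ ∀ i, m < i → Subsingleton (N.space i) := by
    obtain ⟨m, hm⟩ := (Set.toFinite {i | Nontrivial (N.space i)}).exists_maximal hne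
    refine ⟨m, hm.1, fun i hi => ?_⟩
    by_contra h
    exact hi.not_ge (hm.2 (not_subsingleton_iff_nontrivial.1 h) hi.le)
  -- If each step of the chain had B ≤ A, the chain from ⊥ would never leave ⊥.
  obtain ⟨A, B, hAB, hle⟩ : ∃ A B, IsStrip N m A B ∧ ¬B ≤ A := by
    by_contra! h
    have : ∀ B, Relation.ReflTransGen (IsStrip N m) ⊥ B → B ≤ ⊥ := by
      intro B hB
      induction hB with
      | refl => exact le_rfl
      | tail _ h' ih => exact (h _ _ h').trans ih
    exact bot_ne_top (le_bot_iff.1 (this _ (reflTransGen_isStrip hQ N m m.2))).symm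
  obtain ⟨v, hvB, hvA⟩ := Set.not_subset.1 hle
  obtain ⟨ξ, hξv, hξA⟩ : ∃ ξ : N.space m →ₗ[k] k, ξ v = 1 ∧ A ≤ LinearMap.ker ξ := by
    obtain ⟨ξ, hξ, hA⟩ := Submodule.exists_le_ker_of_notMem hvA
    refine ⟨(ξ v)⁻¹ • ξ, by simp [hξ], fun x hx => ?_⟩
    have : ξ x = 0 := hA hx
    simp [this]
  obtain ⟨a, ham, hB, hA⟩ := hAB
  obtain ⟨w, rfl, hw⟩ := hB v hvB
  obtain ⟨ζ, rfl, hζ⟩ := hA ξ hξA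
  let I : Set (Fin n) := posIcc Fin.val (a, (m : ℕ))
  have hmI : m ∈ I := ⟨ham, le_rfl⟩
  let ι : thinRep k Q I ⟶ N := QRep.mkHom (fun i => (coordAt I i).smulRight (w i)) <| by
    intro i j f x
    rw [LinearMap.smulRight_apply, LinearMap.smulRight_apply, map_smul, thinRep_arrowMap]
    by_cases hi : i ∈ I
    · by_cases hj : (j : ℕ) ≤ m
      · rw [hw.2 i j f hi.2 hj hi.1]
        by_cases hjI : j ∈ I
        · rw [coordAt_constAt_of_mem hjI]
        · rw [hw.1 j hjI, smul_zero, smul_zero]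
      · exact (hmax j (by simpa using hj)).elim _ _
    · rw [coordAt_of_notMem hi, map_zero, map_zero, zero_smul, zero_smul]
  let π : N ⟶ thinRep k Q I := QRep.mkHom (fun i => constAt I i ∘ₗ ζ i) <| by
    intro i j f x
    apply coordAt_injective
    rw [thinRep_arrowMap, LinearMap.comp_apply, LinearMap.comp_apply]
    by_cases hj : j ∈ I
    · rw [coordAt_constAt_of_mem hj, coordAt_constAt_of_mem hj]
      by_cases hi : (i : ℕ) ≤ m
      · have := LinearMap.congr_fun (hζ.2 i j f hi hj.2 hj.1) x
        rw [LinearMap.comp_apply] at this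
        rw [this]
        by_cases hiI : i ∈ I
        · rw [coordAt_constAt_of_mem hiI]
        · rw [hζ.1 i hiI, LinearMap.zero_apply, map_zero, map_zero]
      · have := hmax i (by simpa using hi)
        rw [Subsingleton.elim x 0]
        simp
    · rw [coordAt_of_notMem hj, coordAt_of_notMem hj]
  -- An endomorphism of an interval representation is a scalar, and at m this scalar is ξ v = 1.
  have hιπ : ι ≫ π = 𝟙 _ := by
    obtain ⟨c, hc⟩ := hQ.exists_scalar (I := (a, (m : ℕ)))
      (fun t _ h => ⟨⟨t, lt_of_le_of_lt h m.2⟩, rfl⟩) (ι ≫ π)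
    have hc1 : c = 1 := by
      have := hc m (constAt I m 1)
      rw [coordAt_constAt_of_mem hmI, mul_one, QRep.homAt_comp, QRep.homAt_mkHom,
        QRep.homAt_mkHom, LinearMap.smulRight_apply, LinearMap.comp_apply,
        coordAt_constAt_of_mem hmI, coordAt_constAt_of_mem hmI, one_smul, hξv] at this
      exact this.symm
    refine QRep.hom_ext fun i x => coordAt_injective _ _ ?_
    rw [hc, hc1, one_mul, QRep.homAt_id]
  exact ⟨a, m, ham, nonempty_iso_of_retraction hN (not_isZero_thinRep hmI) ι π hιπ⟩

end Gabriel

/-! ### Construction of tilting families by a sweep along the line -/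

section Combinatorics

variable {o : ℕ → Prop}

open Classical in
/-- The linear order on left ends for which `LeftBlock` is the strict order. -/
def leftRank (o : ℕ → Prop) (a : ℕ) : ℤ := if o (a - 1) then a else -a

/-- Left ends entered by an upward arrow rank above all others and increase, while the others
decrease. The truncated predecessor of 0 is harmless, since 0 has rank 0 in both cases. Totality of
this order is what makes the sorting in the sweep possible. -/
lemma leftBlock_iff (a c : ℕ) : LeftBlock o a c ↔ leftRank o a < leftRank o c := by
  unfold LeftBlock leftRank
  rcases lt_trichotomy a c with h | rfl | h
  · by_cases h2 : o (c - 1)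
    · simp only [h2, h, if_true]
      split_ifs <;> simp <;> omega
    · simp only [h2, if_false]
      split_ifs <;> simp <;> omega
  · simp
  · by_cases h2 : o (a - 1)
    · simp only [h2, if_true]
      split_ifs <;> simp <;> omega
    · simp only [h2, h, if_false]
      split_ifs <;> simp <;> omega

/-- A family of intervals in `S ∩ [0, n)` without extensions between them, which covers
`S ∩ [0, n)` and has as many members as this set. -/
structure IsTiltingFamily (o : ℕ → Prop) (S : Set ℕ) (n : ℕ) (F : Finset (ℕ × ℕ)) : Prop where
  le : ∀ I ∈ F, I.1 ≤ I.2
  lt : ∀ I ∈ F, I.2 < n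
  mem : ∀ I ∈ F, ∀ t, I.1 ≤ t → t ≤ I.2 → t ∈ S
  extVanish : ∀ I ∈ F, ∀ J ∈ F, ExtVanish o I J
  card : F.card = (S ∩ Set.Iio n).ncard
  cover : ∀ t < n, t ∈ S → ∃ I ∈ F, I.1 ≤ t ∧ t ≤ I.2

/-- A set of real weights can be cut into an initial segment, a threshold element and the rest so
that a given total lies between the two partial sums. -/
lemma exists_threshold (A : Finset ℕ) (μ : ℕ → ℤ) (c : ℕ → ℝ) (n : ℕ) (hn : n ∉ A) {y : ℝ}
    (hy : 0 ≤ y) :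
    ∃ L ⊆ A, ∃ s ∉ L, ∑ a ∈ L, c a ≤ y ∧
      ((s ∈ A ∧ y ≤ ∑ a ∈ L, c a + c s) ∨ (s = n ∧ L = A)) ∧
      ∀ a' ∈ insert s L, ∀ a ∈ A, a ∉ L → μ a' ≤ μ a := by
  induction A using Finset.induction_on_max_value μ with
  | empty => exact ⟨∅, subset_rfl, n, by simp, by simpa, by simp, by simp⟩
  | insert a A haA hmax ih =>
    obtain ⟨L, hL, s, hs, hle, h, hord⟩ := ih fun h => hn (Finset.mem_insert_of_mem h)
    rcases h with ⟨hsA, hys⟩ | ⟨rfl, rfl⟩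
    · refine ⟨L, hL.trans (Finset.subset_insert _ _), s, hs, hle,
        Or.inl ⟨Finset.mem_insert_of_mem hsA, hys⟩, fun a' ha' b hb hbL => ?_⟩
      rcases Finset.mem_insert.1 hb with rfl | hb
      · refine hmax a' ?_
        rcases Finset.mem_insert.1 ha' with rfl | h
        exacts [hsA, hL h]
      · exact hord a' ha' b hb hbL
    · by_cases hya : y ≤ ∑ b ∈ L, c b + c a
      · refine ⟨L, Finset.subset_insert _ _, a, haA, hle,
          Or.inl ⟨Finset.mem_insert_self _ _, hya⟩, fun a' ha' b hb hbL => ?_⟩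
        obtain rfl := (Finset.mem_insert.1 hb).resolve_right hbL
        rcases Finset.mem_insert.1 ha' with rfl | h
        exacts [le_rfl, hmax a' h]
      · refine ⟨insert a L, subset_rfl, s, hn, ?_, Or.inr ⟨rfl, rfl⟩,
          fun a' _ b hb hbL => (hbL hb).elim⟩
        rw [Finset.sum_insert haA]
        linarith

/-- Adding the position `n` to a family: the intervals `[a, n - 1]` with `a ∈ L` are replaced by
`[a, n]`, and the interval `[s, n]` is added. -/
def extendFamily (F : Finset (ℕ × ℕ)) (n : ℕ) (L : Finset ℕ) (s : ℕ) : Finset (ℕ × ℕ) :=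
  (F \ L.image fun a => (a, n - 1)) ∪ (insert s L).image fun a => (a, n)

/-- The left ends of the intervals of a family which end at `n - 1`. -/
def lastStarts (F : Finset (ℕ × ℕ)) (n : ℕ) : Finset ℕ :=
  (Finset.range n).filter fun a => (a, n - 1) ∈ F

lemma IsTiltingFamily.extend {S : Set ℕ} {n : ℕ} {F : Finset (ℕ × ℕ)}
    (hF : IsTiltingFamily o S n F) (hn : n ∈ S) {L : Finset ℕ} (hL : L ⊆ lastStarts F n)
    {s : ℕ} (hs : s ∉ L) (hsA : s ∈ lastStarts F n ∨ (s = n ∧ L = lastStarts F n))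
    (hord : ∀ a' ∈ insert s L, ∀ a ∈ lastStarts F n, a ∉ L →
      (o (n - 1) → ¬LeftBlock o a a') ∧ (¬o (n - 1) → ¬LeftBlock o a' a)) :
    IsTiltingFamily o S (n + 1) (extendFamily F n L s) := by
  have hold : ∀ I ∈ F \ L.image (fun a => (a, n - 1)), I ∈ F ∧ I.1 ≤ I.2 ∧ I.2 < n ∧
      (I.2 + 1 = n → I.1 ∈ lastStarts F n ∧ I.1 ∉ L) := by
    rintro ⟨c, d⟩ hI
    obtain ⟨hI, hIL⟩ := Finset.mem_sdiff.1 hI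
    refine ⟨hI, hF.le _ hI, hF.lt _ hI, fun h => ?_⟩
    have hd : d = n - 1 := by simp only at h; omega
    subst hd
    refine ⟨Finset.mem_filter.2 ⟨?_, hI⟩, fun h' => hIL (Finset.mem_image_of_mem _ h')⟩
    have := hF.le _ hI
    have := hF.lt _ hI
    simp only at *
    exact Finset.mem_range.2 (by omega)
  have hnew : ∀ a ∈ insert s L,
      (a < n ∧ (a, n - 1) ∈ F) ∨ (a = n ∧ ∀ b ∈ lastStarts F n, b ∈ L) := by
    intro a ha
    have h : ∀ b ∈ lastStarts F n, b < n ∧ (b, n - 1) ∈ F := fun b hb =>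
      ⟨Finset.mem_range.1 (Finset.mem_filter.1 hb).1, (Finset.mem_filter.1 hb).2⟩
    rcases Finset.mem_insert.1 ha with rfl | ha
    · rcases hsA with hsA | ⟨rfl, rfl⟩
      · exact Or.inl (h _ hsA)
      · exact Or.inr ⟨rfl, fun _ hb => hb⟩
    · exact Or.inl (h _ (hL ha))
  have hmem : ∀ I ∈ extendFamily F n L s, I ∈ F \ L.image (fun a => (a, n - 1)) ∨
      ∃ a ∈ insert s L, I = (a, n) := by
    intro I hI
    rcases Finset.mem_union.1 hI with h | h
    · exact Or.inl h
    · obtain ⟨a, ha, rfl⟩ := Finset.mem_image.1 h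
      exact Or.inr ⟨a, ha, rfl⟩
  have hnewle : ∀ a ∈ insert s L, a ≤ n := fun a ha => by
    rcases hnew a ha with h | h <;> omega
  have hnm : ∀ I ∈ F \ L.image (fun a => (a, n - 1)), ∀ a ∈ insert s L,
      ExtVanish o I (a, n) ∧ ExtVanish o (a, n) I := by
    rintro ⟨c, d⟩ hI a ha
    obtain ⟨hIF, hle, hlt, hlast⟩ := hold _ hI
    simp only at hle hlt hlast
    by_cases hd : d + 1 = n
    · obtain ⟨hcA, hcL⟩ := hlast hd
      -- The fresh interval [n, n] is added only when every interval ending at n - 1 is prolonged,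
      -- so it is never adjacent to a remaining one.
      have han := (hnew a ha).resolve_right fun h => hcL (h.2 _ hcA)
      have hdn : d = n - 1 := by omega
      have h := hord a ha c hcA hcL
      rw [← hdn] at h
      simp only [ExtVanish, RightBlock]
      have hd' : d < n := hlt
      refine ⟨⟨by omega, by omega, fun _ _ h' => ?_⟩, ⟨by omega, by omega, fun _ _ h' => ?_⟩⟩
      · rcases h'.2 with h2 | h2
        · exact h.1 h2.2 h'.1
        · omega
      · rcases h'.2 with h2 | h2
        · omega
        · exact h.2 h2.2 h'.1
    -- For d < n - 1 the right block condition against the end n is the same as against n - 1, so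
    -- the old relation with [a, n - 1] carries over.
    · rcases hnew a ha with ⟨han, haF⟩ | ⟨rfl, -⟩
      · have h1 := hF.extVanish _ hIF _ haF
        have h2 := hF.extVanish _ haF _ hIF
        simp only [ExtVanish, RightBlock] at h1 h2 ⊢
        have hd1 : d < n - 1 := by omega
        have hd2 : ¬n - 1 < d := by omega
        have hd3 : ¬n < d := by omega
        simp only [hd1, hd2, hd3, hlt, true_and, false_and, or_false, false_or] at h1 h2 ⊢
        exact ⟨⟨h1.1, by omega, fun _ h => h1.2.2 (by omega) h⟩,
          ⟨by omega, h1.1, fun h h' => h2.2.2 h (by omega)⟩⟩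
      · refine ⟨⟨hd, by simp only; omega, fun _ h => ?_⟩, ⟨by simp only; omega, hd, fun h => ?_⟩⟩
        · simp only at h; omega
        · simp only at h; omega
  refine ⟨fun I hI => ?_, fun I hI => ?_, fun I hI t h1 h2 => ?_, fun I hI J hJ => ?_, ?_,
    fun t ht htS => ?_⟩
  · rcases hmem I hI with h | ⟨a, ha, rfl⟩
    exacts [(hold I h).2.1, hnewle a ha]
  · rcases hmem I hI with h | ⟨a, ha, rfl⟩
    exacts [(hold I h).2.2.1.trans (Nat.lt_succ_self _), Nat.lt_succ_self _]
  · rcases hmem I hI with h | ⟨a, ha, rfl⟩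
    · exact hF.mem I (hold I h).1 t h1 h2
    · simp only at h1 h2
      rcases hnew a ha with ⟨han, haF⟩ | ⟨rfl, -⟩
      · rcases h2.eq_or_lt with rfl | h2
        · exact hn
        · exact hF.mem _ haF t h1 (by simp only; omega)
      · exact le_antisymm h1 h2 ▸ hn
  · rcases hmem I hI with h | ⟨a, ha, rfl⟩
    · rcases hmem J hJ with h' | ⟨b, hb, rfl⟩
      · exact hF.extVanish I (hold I h).1 J (hold J h').1
      · exact (hnm I h b hb).1
    · rcases hmem J hJ with h' | ⟨b, hb, rfl⟩
      · exact (hnm J h' a ha).2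
      · have := hnewle a ha
        have := hnewle b hb
        refine ⟨by simp only; omega, by simp only; omega, fun _ _ h => ?_⟩
        simp [RightBlock] at h
  · have hLF : L.image (fun a => (a, n - 1)) ⊆ F := fun I hI => by
      obtain ⟨a, ha, rfl⟩ := Finset.mem_image.1 hI
      exact (Finset.mem_filter.1 (hL ha)).2
    have hinj : ∀ m : ℕ, Function.Injective fun a : ℕ => (a, m) := fun m a b h =>
      (Prod.mk.inj h).1
    have hset : S ∩ Set.Iio (n + 1) = insert n (S ∩ Set.Iio n) := by
      ext t
      simp only [Set.mem_inter_iff, Set.mem_Iio, Set.mem_insert_iff]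
      constructor
      · rintro ⟨h1, h2⟩
        by_cases h : t = n
        · exact Or.inl h
        · exact Or.inr ⟨h1, by omega⟩
      · rintro (rfl | h)
        · exact ⟨hn, by omega⟩
        · exact ⟨h.1, by omega⟩
    have hle := Finset.card_le_card hLF
    rw [Finset.card_image_of_injective _ (hinj _)] at hle
    rw [extendFamily, Finset.card_union_of_disjoint, Finset.card_sdiff_of_subset hLF,
      Finset.card_image_of_injective _ (hinj _), Finset.card_image_of_injective _ (hinj _),
      Finset.card_insert_of_notMem hs, hset, Set.ncard_insert_of_notMem (by simp)
        ((Set.finite_Iio n).subset Set.inter_subset_right), ← hF.card]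
    · omega
    · refine Finset.disjoint_left.2 fun I hI hI' => ?_
      obtain ⟨a, -, rfl⟩ := Finset.mem_image.1 hI'
      exact absurd (hold _ hI).2.2.1 (lt_irrefl n)
  · rcases (Nat.lt_succ_iff.1 ht).eq_or_lt with rfl | ht
    · exact ⟨(s, t), Finset.mem_union_right _ (Finset.mem_image_of_mem _
        (Finset.mem_insert_self _ _)), hnewle s (Finset.mem_insert_self _ _), le_rfl⟩
    · obtain ⟨I, hI, h1, h2⟩ := hF.cover t ht htS
      by_cases h : I ∈ L.image fun a => (a, n - 1)
      · obtain ⟨a, ha, rfl⟩ := Finset.mem_image.1 h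
        exact ⟨(a, n), Finset.mem_union_right _ (Finset.mem_image_of_mem _
          (Finset.mem_insert_of_mem ha)), h1, ht.le⟩
      · exact ⟨I, Finset.mem_union_left _ (Finset.mem_sdiff.2 ⟨hI, h⟩), h1, h2⟩

open Classical in
/-- Every nonnegative vector on `S` lies in the cone of a tilting family. -/
theorem exists_isTiltingFamily (o : ℕ → Prop) (S : Set ℕ) (x : ℕ → ℝ) (hx : ∀ t ∈ S, 0 ≤ x t)
    (N : ℕ) : ∀ n ≤ N, ∃ (F : Finset (ℕ × ℕ)) (c : ℕ → ℕ → ℝ), IsTiltingFamily o S n F ∧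
      (∀ a b, 0 ≤ c a b) ∧ (∀ a b, (a, b) ∉ F → c a b = 0) ∧
      ∀ t < n, t ∈ S → x t = ∑ a ∈ Finset.range N, ∑ b ∈ Finset.range N,
        if a ≤ t ∧ t ≤ b then c a b else 0 := by
  intro n
  induction n with
  | zero =>
    intro _
    exact ⟨∅, fun _ _ => 0, ⟨by simp, by simp, by simp, by simp, by simp, by simp⟩, by simp,
      by simp, by simp⟩
  | succ n ih =>
    intro hnN
    obtain ⟨F, c, hF, hc, hcF, hxc⟩ := ih (by omega)
    by_cases hn : n ∈ S
    -- The arrow between n - 1 and n decides in which direction [a, n - 1] and [a', n] are blocked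
    -- on the right; the sign of the rank makes the left ends unblocked in that direction.
    · obtain ⟨L, hL, s, hs, hle, hsA, hord⟩ := exists_threshold (lastStarts F n)
        (fun a => if o (n - 1) then leftRank o a else -leftRank o a) (fun a => c a (n - 1)) n
        (by simp [lastStarts]) (hx n hn)
      have hF' := hF.extend (L := L) (s := s) hn hL hs (hsA.imp And.left id)
        fun a' ha' a ha haL => by
          have := hord a' ha' a ha haL
          rw [leftBlock_iff, leftBlock_iff]
          constructor <;> intro h <;> simp only [h, if_true, if_false] at this <;> omega
      -- Here e' a is the weight given to [a, n] and e a the weight taken from [a, n - 1]. They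
      -- differ only in the fresh interval a = n, which has no predecessor.
      let e' : ℕ → ℝ := fun a => if a ∈ L then c a (n - 1) else
        if a = s then x n - ∑ a ∈ L, c a (n - 1) else 0
      let e : ℕ → ℝ := fun a => if a < n then e' a else 0
      have hLn : ∀ a ∈ lastStarts F n, a < n := fun a ha =>
        Finset.mem_range.1 (Finset.mem_filter.1 ha).1
      have he'0 : ∀ a, 0 ≤ e' a := fun a => by
        simp only [e']
        split_ifs
        exacts [hc _ _, sub_nonneg.2 hle, le_rfl]
      have hec : ∀ a, e a ≤ c a (n - 1) := fun a => by
        simp only [e, e']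
        split_ifs with h1 h2 h3
        · exact le_rfl
        · subst h3
          rcases hsA with h | h
          · linarith [h.2]
          · omega
        · exact hc _ _
        · exact hc _ _
      have hsn : s ≤ n := by
        rcases hsA with h | h
        exacts [(hLn s h.1).le, h.1.le]
      have he'F : ∀ a, a ∉ insert s L → e' a = 0 := fun a ha => by
        rw [Finset.mem_insert, not_or] at ha
        simp only [e', ha.1, ha.2, if_false]
      have hcn : ∀ a b, n ≤ b → c a b = 0 := fun a b hb =>
        hcF a b fun h => absurd (hF.lt _ h) (by simpa using hb)
      refine ⟨extendFamily F n L s, fun a b => c a b + (if b = n then e' a else 0) -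
        if b + 1 = n then e a else 0, hF', fun a b => ?_, fun a b hab => ?_, fun t ht htS => ?_⟩
      · have h1 := hec a
        have h2 := he'0 a
        have h3 := hc a b
        by_cases hb : b + 1 = n
        · have : b = n - 1 := by omega
          subst this
          simp only [if_neg (show ¬n - 1 = n by omega), if_pos hb]
          linarith
        · simp only [if_neg hb]
          split_ifs <;> linarith
      · rw [extendFamily, Finset.mem_union, not_or] at hab
        by_cases hbn : b = n
        · subst hbn
          have : a ∉ insert s L := fun h => hab.2 (Finset.mem_image_of_mem _ h)
          simp [hcn a b le_rfl, he'F a this]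
        by_cases hb : b + 1 = n
        · have hb' : b = n - 1 := by omega
          simp only [if_neg hbn, if_pos hb, add_zero, sub_eq_zero]
          by_cases hF : (a, b) ∈ F
          · have haL : a ∈ L := by
              by_contra haL
              refine hab.1 (Finset.mem_sdiff.2 ⟨hF, fun h => haL ?_⟩)
              obtain ⟨a', ha', h⟩ := Finset.mem_image.1 h
              exact (Prod.mk.inj h).1 ▸ ha'
            simp only [e, e', if_pos (hLn a (hL haL)), if_pos haL, hb']
          · have h0 := hcF a b hF
            have h1 := hec a
            rw [← hb', h0] at h1
            have h2 : 0 ≤ e a := by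
              simp only [e]
              split_ifs
              exacts [he'0 a, le_rfl]
            rw [h0]
            exact le_antisymm h2 h1
        · have : (a, b) ∉ F := fun hF => hab.1 (Finset.mem_sdiff.2 ⟨hF, fun h => by
            obtain ⟨a', ha', h⟩ := Finset.mem_image.1 h
            have := hLn a' (hL ha')
            have := (Prod.mk.inj h).2
            omega⟩)
          simp [hcF a b this, hbn, hb]
      · rcases (Nat.lt_succ_iff.1 ht).eq_or_lt with rfl | ht
        · have h1 : ∀ a, (∑ b ∈ Finset.range N, if a ≤ t ∧ t ≤ b then
              c a b + (if b = t then e' a else 0) - (if b + 1 = t then e a else 0) else 0) =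
              e' a := by
            intro a
            rw [Finset.sum_eq_single t]
            · by_cases hat : a ≤ t
              · simp [hat, hcn a t le_rfl]
              · have : a ∉ insert s L := fun h => by
                  rcases Finset.mem_insert.1 h with rfl | h
                  · exact hat hsn
                  · exact hat (hLn a (hL h)).le
                simp [hat, he'F a this]
            · intro b _ hb
              refine ite_eq_right_iff.2 fun h2 => ?_
              simp [hcn a b h2.2, hb, show b + 1 ≠ t by omega]
            · intro h
              exact absurd (Finset.mem_range.2 hnN) h
          have h2 : ∑ a ∈ L, e' a = ∑ a ∈ L, c a (t - 1) :=
            Finset.sum_congr rfl fun a ha => if_pos ha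
          rw [Finset.sum_congr rfl fun a _ => h1 a, ← Finset.sum_subset (s₁ := insert s L),
            Finset.sum_insert hs, h2, if_neg hs,
            if_pos rfl]
          · ring
          · intro a ha
            refine Finset.mem_range.2 (lt_of_lt_of_le (Nat.lt_succ_of_le ?_) hnN)
            rcases Finset.mem_insert.1 ha with rfl | h
            exacts [hsn, (hLn a (hL h)).le]
          · exact fun a _ ha => he'F a ha
        · rw [hxc t ht htS]
          refine Finset.sum_congr rfl fun a _ => ?_
          by_cases hat : a ≤ t
          -- For a ≤ t < n both [a, n - 1] and [a, n] contain t, so moving weight between them does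
          -- not change the coordinate t.
          · have h1 : ∀ b, (if a ≤ t ∧ t ≤ b then
                c a b + (if b = n then e' a else 0) - (if b + 1 = n then e a else 0) else 0) =
                (if a ≤ t ∧ t ≤ b then c a b else 0) + ((if b = n then e' a else 0) -
                  if b = n - 1 then e' a else 0) := by
              intro b
              have he : e a = e' a := if_pos (by omega)
              rw [he]
              by_cases hb : t ≤ b
              · simp only [hat, hb, and_self, if_true, show b + 1 = n ↔ b = n - 1 by omega]
                ring
              · simp [hb, show b ≠ n by omega, show b ≠ n - 1 by omega]
            rw [Finset.sum_congr rfl fun b _ => h1 b, Finset.sum_add_distrib,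
              Finset.sum_sub_distrib, Finset.sum_ite_eq', Finset.sum_ite_eq',
              if_pos (Finset.mem_range.2 hnN), if_pos (Finset.mem_range.2 (by omega)), sub_self,
              add_zero]
          · simp [hat]
    -- A vertex outside S leaves everything unchanged. No interval then ends there, so the sweep
    -- restarts afresh at the next vertex of S.
    · refine ⟨F, c, ⟨hF.le, fun I hI => (hF.lt I hI).trans (Nat.lt_succ_self _), hF.mem,
        hF.extVanish, ?_, fun t ht htS => ?_⟩, hc, hcF, fun t ht htS => ?_⟩
      · rw [hF.card]
        congr 1
        ext t
        simp only [Set.mem_inter_iff, Set.mem_Iio, and_congr_right_iff]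
        intro htS
        have : t ≠ n := fun h => hn (h ▸ htS)
        omega
      · have : t ≠ n := fun h => hn (h ▸ htS)
        exact hF.cover t (by omega) htS
      · have : t ≠ n := fun h => hn (h ▸ htS)
        exact hxc t (by omega) htS

end Combinatorics

/-! ### Support, summands and rigidity of finite direct sums -/

section Biproducts

variable {k : Type u} [Field k] {V : Type w} {Q : Quiver.{v} V}

lemma QRep.homAt_sum {M N : QRep k Q} {ι : Type*} (s : Finset ι) (f : ι → (M ⟶ N)) (i : V)
    (x : M.space i) : homAt (∑ j ∈ s, f j) i x = ∑ j ∈ s, homAt (f j) i x := by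
  induction s using Finset.cons_induction with
  | empty => simp
  | cons a s ha ih =>
    rw [Finset.sum_cons, Finset.sum_cons, ← ih]
    rfl

lemma QRep.biproduct_π_injective {ι : Type} [Fintype ι] (X : ι → QRep k Q) [HasBiproduct X]
    (i : V) : Function.Injective fun (x : (⨁ X).space i) j => homAt (biproduct.π X j) i x := by
  intro x y hxy
  have h : ∀ z : (⨁ X).space i,
      z = ∑ j, homAt (biproduct.ι X j) i (homAt (biproduct.π X j) i z) := by
    intro z
    have ht : ∑ j, biproduct.π X j ≫ biproduct.ι X j = 𝟙 (⨁ X) := biproduct.total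
    have := congrArg (fun φ => homAt φ i z) ht
    simp only [homAt_sum] at this
    exact this.symm
  rw [h x, h y]
  exact Finset.sum_congr rfl fun j _ => congrArg _ (congrFun hxy j)

lemma isFinDim_biproduct {ι : Type} [Fintype ι] (X : ι → QRep k Q) [HasBiproduct X]
    (hX : ∀ j, IsFinDim (X j)) : IsFinDim (⨁ X) := fun i =>
  have := fun j => hX j i
  FiniteDimensional.of_injective (LinearMap.pi fun j => QRep.homAt (biproduct.π X j) i)
    (QRep.biproduct_π_injective X i)

lemma mem_supp_iff {M : QRep k Q} (hM : IsFinDim M) (i : V) :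
    i ∈ supp M ↔ Nontrivial (M.space i) := by
  have := hM i
  change Module.finrank k (M.space i) ≠ 0 ↔ _
  rw [← Nat.pos_iff_ne_zero, Module.finrank_pos_iff]

lemma mem_supp_biproduct_iff {ι : Type} [Fintype ι] (X : ι → QRep k Q) [HasBiproduct X]
    (hX : ∀ j, IsFinDim (X j)) (i : V) : i ∈ supp (⨁ X) ↔ ∃ j, i ∈ supp (X j) := by
  classical
  rw [mem_supp_iff (isFinDim_biproduct X hX)]
  simp only [mem_supp_iff (hX _)]
  constructor
  · intro h
    by_contra! h'
    exact not_subsingleton _ (QRep.biproduct_π_injective X i).subsingleton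
  · rintro ⟨j, hj⟩
    refine Function.Injective.nontrivial (f := QRep.homAt (biproduct.ι X j) i) ?_
    refine Function.LeftInverse.injective (g := QRep.homAt (biproduct.π X j) i) fun x => ?_
    rw [← QRep.homAt_comp, biproduct.ι_π_self, QRep.homAt_id]

lemma isIndecSummand_biproduct {ι : Type} [Fintype ι] (X : ι → QRep k Q) [HasBiproduct X]
    (j : ι) (hX : Indecomposable (X j)) : IsIndecSummand (X j) (⨁ X) := by
  classical
  exact ⟨hX, exists_iso_biprod_of_retraction (biproduct.ι X j) (biproduct.π X j)
    (biproduct.ι_π_self X j)⟩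

/-- Ext¹ is additive in both variables, and conjugation by `e` carries the vanishing to T. -/
lemma isRigid_of_iso_biproduct {ι : Type} [Fintype ι] {X : ι → QRep k Q} [HasBiproduct X]
    {T : QRep k Q} (e : T ≅ ⨁ X)
    (h : letI : HasExt (QRep k Q) := HasExt.standard (QRep k Q)
      ∀ i j, Subsingleton (Abelian.Ext (X i) (X j) 1)) : IsRigid T := by
  let : HasExt (QRep k Q) := HasExt.standard (QRep k Q)
  have h1 : ∀ i, Subsingleton (Abelian.Ext (X i) (⨁ X) 1) := fun i =>
    have := h i
    (Abelian.Ext.addEquivBiproduct (X i) (biproduct.isBilimit X) 1).toEquiv.subsingleton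
  have h2 : Subsingleton (Abelian.Ext (⨁ X) (⨁ X) 1) :=
    (Abelian.Ext.biproductAddEquiv (biproduct.isBilimit X) (⨁ X) 1).toEquiv.subsingleton
  refine subsingleton_of_forall_eq 0 fun x => ?_
  have h3 : ((Abelian.Ext.mk₀ e.inv).comp x (zero_add 1)).comp (Abelian.Ext.mk₀ e.hom)
      (add_zero 1) = 0 := Subsingleton.elim _ _
  have h4 : (Abelian.Ext.mk₀ e.hom).comp ((((Abelian.Ext.mk₀ e.inv).comp x (zero_add 1)).comp
      (Abelian.Ext.mk₀ e.hom) (add_zero 1)).comp (Abelian.Ext.mk₀ e.inv) (add_zero 1))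
      (zero_add 1) = x := by
    simp
  rw [← h4, h3, Abelian.Ext.zero_comp, Abelian.Ext.comp_zero]

end Biproducts

/-! ### Tilting modules from families of intervals -/

section Tilting

variable {k : Type u} [Field k] {V : Type w} {Q : Quiver.{v} V} {pos : V → ℕ} {o : ℕ → Prop}

lemma IsLinear.isTilting (hQ : IsLinear Q pos o) {ι : Type} [Fintype ι] (X : ι → ℕ × ℕ)
    (hX : Function.Injective X) (hcard : Nat.card V = Fintype.card ι)
    (hle : ∀ j, (X j).1 ≤ (X j).2) (hV : ∀ j t, (X j).1 ≤ t → t ≤ (X j).2 → ∃ i, pos i = t)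
    (hext : ∀ j j', ExtVanish o (X j) (X j')) [HasFiniteBiproducts (QRep k Q)]
    {T : QRep k Q} (e : T ≅ ⨁ fun j => thinRep k Q (posIcc pos (X j))) : IsTilting T := by
  refine ⟨isFinDim_of_iso e.symm (isFinDim_biproduct _ fun j => isFinDim_thinRep _),
    ?_, ?_⟩
  · let : HasExt (QRep k Q) := HasExt.standard (QRep k Q)
    exact isRigid_of_iso_biproduct e fun j j' => hQ.subsingleton_ext_one (hext j j')
  let ε : Fin (Nat.card V) ≃ ι := (finCongr hcard).trans (Fintype.equivFin ι).symm
  refine ⟨fun i => thinRep k Q (posIcc pos (X (ε i))),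
    fun i => hQ.indecomposable_thinRep (hle _) (hV _), fun i j hij => ⟨fun α => hij ?_⟩,
    ⟨e ≪≫ (biproduct.whiskerEquiv ε fun i => Iso.refl _).symm⟩⟩
  -- The dimension vector recovers both ends of the interval, so distinct intervals give
  -- non-isomorphic summands.
  have hdim := dimVec_eq_of_iso α
  have hsub : ∀ j j', (∀ i, dimVec (thinRep k Q (posIcc pos (X j))) i =
      dimVec (thinRep k Q (posIcc pos (X j'))) i) → ∀ t, (X j).1 ≤ t → t ≤ (X j).2 →
      (X j').1 ≤ t ∧ t ≤ (X j').2 := by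
    classical
    intro j j' h t h1 h2
    obtain ⟨i, rfl⟩ := hV j t h1 h2
    have := h i
    rw [dimVec_thinRep, dimVec_thinRep, if_pos ⟨h1, h2⟩] at this
    by_contra hn
    rw [if_neg (show i ∉ posIcc pos (X j') from hn)] at this
    exact one_ne_zero this
  have h1 := hsub _ _ (congrFun hdim) _ le_rfl (hle _)
  have h2 := hsub _ _ (congrFun hdim) _ (hle _) le_rfl
  have h3 := hsub _ _ (fun i => (congrFun hdim i).symm) _ le_rfl (hle _)
  have h4 := hsub _ _ (fun i => (congrFun hdim i).symm) _ (hle _) le_rfl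
  exact ε.injective (hX (Prod.ext (le_antisymm h3.1 h1.1) (le_antisymm h2.2 h4.2)))

/-- This is the purpose of the position map: a full subquiver with gaps keeps the ambient positions
and orientation, so the results on Ext¹ apply to restrictions unchanged. -/
lemma IsLinear.fullSubquiver (hQ : IsLinear Q pos o) (S : Set V) :
    IsLinear (QuiverTilting.fullSubquiver Q S) (fun i => pos i) o where
  injective := hQ.injective.comp Subtype.val_injective
  subsingleton i j := hQ.subsingleton i.1 j.1
  hom i j f := hQ.hom i.1 j.1 f
  up i j := hQ.up i.1 j.1
  down i j := hQ.down i.1 j.1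

variable (k Q) in
/-- Restriction to a full subquiver, as a functor. -/
def restrictFunctor (S : Set V) : QRep k Q ⥤ QRep k (fullSubquiver Q S) :=
  letI := QuiverTilting.fullSubquiver Q S
  (Functor.whiskeringLeft _ _ _).obj (pathsInclusion Q S)

instance (S : Set V) : (restrictFunctor k Q S).Additive where
  map_add := rfl

/-- The restriction of a thin representation is thin. -/
def restrictThinRep (I : Set V) (S : Set V) :
    restrict (thinRep k Q I) S ≅ thinRep k (fullSubquiver Q S) (Subtype.val ⁻¹' I) :=
  letI := QuiverTilting.fullSubquiver Q S
  Paths.liftNatIso (fun _ => Iso.refl _) fun _ => rfl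

lemma IsLinear.isTilting_restrict (hQ : IsLinear Q pos o) {ι : Type} [Fintype ι] (X : ι → ℕ × ℕ)
    (hX : Function.Injective X) (hle : ∀ j, (X j).1 ≤ (X j).2)
    [HasFiniteBiproducts (QRep k Q)] (S : Set V) (hcard : Nat.card S = Fintype.card ι)
    (hV : ∀ j t, (X j).1 ≤ t → t ≤ (X j).2 → ∃ i ∈ S, pos i = t)
    (hext : ∀ j j', ExtVanish o (X j) (X j')) :
    IsTilting (restrict (⨁ fun j => thinRep k Q (posIcc pos (X j))) S) := by
  have : HasFiniteBiproducts (QRep k (QuiverTilting.fullSubquiver Q S)) :=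
    Abelian.hasFiniteBiproducts
  refine (hQ.fullSubquiver S).isTilting X hX hcard hle (fun j t h1 h2 => ?_) hext
    ((restrictFunctor k Q S).mapBiproduct _ ≪≫
      biproduct.mapIso fun j => restrictThinRep (posIcc pos (X j)) S)
  obtain ⟨i, hi, rfl⟩ := hV j t h1 h2
  exact ⟨⟨i, hi⟩, rfl⟩

end Tilting

/-! ### Quivers of type A, roots and support tilting modules -/

section TypeA

variable {k : Type u} [Field k] {n : ℕ} {Q : Quiver.{v} (Fin n)} {o : ℕ → Prop}

lemma IsTypeA.exists_isLinear (hQ : IsTypeA Q) : ∃ o, IsLinear Q Fin.val o := by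
  refine ⟨fun t => ∃ h : t + 1 < n, Nonempty (Q.Hom ⟨t, by omega⟩ ⟨t + 1, h⟩),
    Fin.val_injective, fun i j => ⟨fun f g => ?_⟩, fun i j f => ?_, fun i j h => ?_,
    fun i j h ho => ?_⟩
  · rcases hQ.adjacent i j ⟨f⟩ with h | h
    · obtain ⟨hu⟩ := hQ.existsUnique_arrow i j h
      exact Sum.inl_injective (Subsingleton.elim (α := Q.Hom i j ⊕ Q.Hom j i) _ _)
    · obtain ⟨hu⟩ := hQ.existsUnique_arrow j i h
      exact Sum.inr_injective (Subsingleton.elim (α := Q.Hom j i ⊕ Q.Hom i j) _ _)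
  · obtain ⟨i, hi⟩ := i
    obtain ⟨j, hj⟩ := j
    rcases hQ.adjacent _ _ ⟨f⟩ with h | h
    · simp only at h
      subst h
      exact Or.inl ⟨rfl, hj, ⟨f⟩⟩
    · simp only at h
      subst h
      refine Or.inr ⟨rfl, fun ⟨_, ⟨g⟩⟩ => ?_⟩
      obtain ⟨hu⟩ := hQ.existsUnique_arrow ⟨j, hj⟩ ⟨j + 1, hi⟩ rfl
      exact Sum.inl_ne_inr (Subsingleton.elim (Sum.inl g) (Sum.inr f))
  · rintro ⟨_, ⟨f⟩⟩
    obtain ⟨j, hj⟩ := j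
    simp only at h
    subst h
    exact ⟨f⟩
  · obtain ⟨j, hj⟩ := j
    simp only at h
    subst h
    obtain ⟨hu⟩ := hQ.existsUnique_arrow i ⟨i + 1, hj⟩ rfl
    rcases hu.default with f | f
    · exact (ho ⟨hj, ⟨f⟩⟩).elim
    · exact ⟨f⟩

/-- The vector with entries `1` on an interval and `0` elsewhere. -/
def rootVec (n : ℕ) (I : ℕ × ℕ) : Fin n → ℝ :=
  fun i => if I.1 ≤ (i : ℕ) ∧ (i : ℕ) ≤ I.2 then 1 else 0

lemma rootVec_mem_posRoots {I : ℕ × ℕ} (h1 : I.1 ≤ I.2) (h2 : I.2 < n) :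
    rootVec n I ∈ posRoots n := by
  refine ⟨⟨I.1, by omega⟩, ⟨I.2, h2⟩, h1, ?_⟩
  funext i
  simp [rootVec, Set.indicator_apply, Fin.le_def]

lemma exists_of_mem_posRoots {d : Fin n → ℝ} (hd : d ∈ posRoots n) :
    ∃ I : ℕ × ℕ, I.1 ≤ I.2 ∧ I.2 < n ∧ d = rootVec n I := by
  obtain ⟨i, j, hij, rfl⟩ := hd
  classical
  refine ⟨(i, j), hij, j.2, ?_⟩
  funext t
  rw [Set.indicator_apply]
  exact if_congr Iff.rfl rfl rfl

lemma realDimVec_thinRep (I : ℕ × ℕ) :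
    realDimVec (thinRep k Q (posIcc Fin.val I)) = rootVec n I := by
  classical
  funext i
  change ((dimVec (thinRep k Q (posIcc Fin.val I)) i : ℕ) : ℝ) = _
  rw [dimVec_thinRep, rootVec, Nat.cast_ite, Nat.cast_one, Nat.cast_zero]
  exact if_congr Iff.rfl rfl rfl

lemma IsLinear.summandDims_subset (hQ : IsLinear Q Fin.val o) (T : QRep k Q) :
    summandDims T ⊆ posRoots n := by
  rintro d ⟨N, ⟨hN, -⟩, rfl⟩
  obtain ⟨a, m, ham, ⟨e⟩⟩ := exists_iso_thinRep hQ hN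
  have : realDimVec N = rootVec n (a, m) := by
    rw [← realDimVec_thinRep (k := k) (Q := Q)]
    funext i
    exact congrArg Nat.cast (congrFun (dimVec_eq_of_iso e) i)
  rw [this]
  exact rootVec_mem_posRoots ham m.2

/-- A family of intervals gives a module whose simplex contains the corresponding roots. -/
lemma IsLinear.exists_isSupportTilting (hQ : IsLinear Q Fin.val o) {S : Set ℕ}
    {F : Finset (ℕ × ℕ)} (hF : IsTiltingFamily o S n F) :
    ∃ T : QRep k Q, IsSupportTilting T ∧ (supp T = Fin.val ⁻¹' S) ∧
      (S = Set.univ → IsTilting T) ∧ ∀ I ∈ F, rootVec n I ∈ summandDims T := by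
  have hB : HasFiniteBiproducts (QRep k Q) := Abelian.hasFiniteBiproducts
  let X : F → QRep k Q := fun I => thinRep k Q (posIcc Fin.val I.1)
  have hfin : ∀ I, IsFinDim (X I) := fun I => isFinDim_thinRep _
  have hV : ∀ (I : F) t, I.1.1 ≤ t → t ≤ I.1.2 → ∃ i : Fin n, (i : ℕ) = t := fun I t _ h =>
    ⟨⟨t, h.trans_lt (hF.lt _ I.2)⟩, rfl⟩
  have hsupp : supp (⨁ X) = Fin.val ⁻¹' S := by
    classical
    ext i
    rw [mem_supp_biproduct_iff X hfin]
    have : ∀ I : F, i ∈ supp (X I) ↔ I.1.1 ≤ (i : ℕ) ∧ (i : ℕ) ≤ I.1.2 := fun I => by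
      change dimVec (thinRep k Q (posIcc Fin.val I.1)) i ≠ 0 ↔ _
      rw [dimVec_thinRep, Ne, ite_eq_right_iff, Classical.not_imp]
      exact and_iff_left one_ne_zero
    simp only [this, Set.mem_preimage]
    constructor
    · rintro ⟨I, h⟩
      exact hF.mem _ I.2 _ h.1 h.2
    · intro h
      obtain ⟨I, hI, h'⟩ := hF.cover i i.2 h
      exact ⟨⟨I, hI⟩, h'⟩
  have hcard : Nat.card (Fin.val ⁻¹' S : Set (Fin n)) = Fintype.card F := by
    rw [Fintype.card_coe, hF.card, Nat.card_coe_set_eq,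
      ← Set.ncard_image_of_injective _ Fin.val_injective]
    congr 1
    ext t
    constructor
    · rintro ⟨i, hi, rfl⟩
      exact ⟨hi, i.2⟩
    · rintro ⟨h1, h2⟩
      exact ⟨⟨t, h2⟩, h1, rfl⟩
  have hext : ∀ I J : F, ExtVanish o I.1 J.1 := fun I J => hF.extVanish _ I.2 _ J.2
  refine ⟨⨁ X, ⟨isFinDim_biproduct X hfin, ?_⟩, hsupp, fun hS => ?_, fun I hI => ?_⟩
  · rw [hsupp]
    exact hQ.isTilting_restrict (fun I : F => I.1) Subtype.val_injective
      (fun I => hF.le _ I.2) _ hcard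
      (fun I t h1 h2 => ⟨⟨t, h2.trans_lt (hF.lt _ I.2)⟩, hF.mem _ I.2 _ h1 h2, rfl⟩) hext
  · refine hQ.isTilting (fun I : F => I.1) Subtype.val_injective ?_ (fun I => hF.le _ I.2) hV
      hext (Iso.refl _)
    rw [← hcard, hS, Set.preimage_univ, Nat.card_congr (Equiv.Set.univ _)]
  · exact ⟨X ⟨I, hI⟩, isIndecSummand_biproduct X ⟨I, hI⟩
      (hQ.indecomposable_thinRep (hF.le _ hI) (hV ⟨I, hI⟩)), (realDimVec_thinRep I).symm⟩

end TypeA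

/-! ### Linear functionals that bound the sum of the weights -/

section Polytopes

variable {n : ℕ} {o : ℕ → Prop}

/-- Every nonnegative vector on `S` is a nonnegative combination of the roots of a tilting
family. -/
lemma exists_isTiltingFamily_sum (o : ℕ → Prop) (S : Set ℕ) [DecidablePred (· ∈ S)]
    (x : Fin n → ℝ) (hx : ∀ i : Fin n, (i : ℕ) ∈ S → 0 ≤ x i) :
    ∃ (F : Finset (ℕ × ℕ)) (c : ℕ × ℕ → ℝ), IsTiltingFamily o S n F ∧ (∀ I, 0 ≤ c I) ∧
      ∑ I ∈ F, c I • rootVec n I = fun i : Fin n => if (i : ℕ) ∈ S then x i else 0 := by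
  classical
  obtain ⟨F, c, hF, hc, hcF, hxc⟩ := exists_isTiltingFamily o S
    (fun t => if h : t < n then x ⟨t, h⟩ else 0)
    (fun t ht => by
      split_ifs with h
      exacts [hx ⟨t, h⟩ ht, le_rfl]) n n le_rfl
  refine ⟨F, fun I => c I.1 I.2, hF, fun I => hc _ _, ?_⟩
  funext i
  rw [Finset.sum_apply]
  simp only [Pi.smul_apply, smul_eq_mul, rootVec, mul_ite, mul_one, mul_zero]
  split_ifs with hi
  · have := hxc i i.2 hi
    rw [dif_pos i.2] at this
    rw [this, ← Finset.sum_product']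
    refine Finset.sum_subset (fun I hI => Finset.mem_product.2 ⟨?_, ?_⟩) fun I _ hI => ?_
    · exact Finset.mem_range.2 ((hF.le I hI).trans_lt (hF.lt I hI))
    · exact Finset.mem_range.2 (hF.lt I hI)
    · rw [hcF _ _ hI, ite_self]
  · refine Finset.sum_eq_zero fun I hI => if_neg fun h => hi (hF.mem I hI _ h.1 h.2)

lemma sum_mul_rootVec (u : ℕ → ℝ) {I : ℕ × ℕ} (h2 : I.2 < n) :
    ∑ i : Fin n, u i * rootVec n I i = ∑ t ∈ Finset.Ico I.1 (I.2 + 1), u t := by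
  simp only [rootVec, mul_ite, mul_one, mul_zero]
  rw [Fin.sum_univ_eq_sum_range (fun t => if I.1 ≤ t ∧ t ≤ I.2 then u t else 0),
    ← Finset.sum_filter]
  refine Finset.sum_congr ?_ fun _ _ => rfl
  ext t
  simp only [Finset.mem_filter, Finset.mem_range, Finset.mem_Ico]
  omega

lemma sum_mul_rootVec_of_eq {u q : ℕ → ℝ} {I : ℕ × ℕ} (h1 : I.1 ≤ I.2) (h2 : I.2 < n)
    (h : ∀ t, I.1 ≤ t → t ≤ I.2 → u t = q t - q (t + 1)) :
    ∑ i : Fin n, u i * rootVec n I i = q I.1 - q (I.2 + 1) := by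
  rw [sum_mul_rootVec u h2, Finset.sum_congr rfl (g := fun t => -(q (t + 1) - q t)),
    Finset.sum_neg_distrib, Finset.sum_Ico_sub q (by omega)]
  · ring
  · intro t ht
    rw [Finset.mem_Ico] at ht
    rw [h t (by omega) (by omega)]
    ring

lemma sum_mul_rootVec_le {u q : ℕ → ℝ} {I : ℕ × ℕ} (h1 : I.1 ≤ I.2) (h2 : I.2 < n)
    (h : ∀ t, u t ≤ q t - q (t + 1)) :
    ∑ i : Fin n, u i * rootVec n I i ≤ q I.1 - q (I.2 + 1) := by
  rw [sum_mul_rootVec u h2, ← sum_mul_rootVec_of_eq (u := fun t => q t - q (t + 1)) h1 h2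
    fun t _ _ => rfl, sum_mul_rootVec (fun t => q t - q (t + 1)) h2]
  exact Finset.sum_le_sum fun t _ => h t

lemma sum_mul_le_one_of_mem_convexHull {A : Set (Fin n → ℝ)} (u : Fin n → ℝ)
    (hA : ∀ y ∈ A, ∑ i, u i * y i ≤ 1) {x : Fin n → ℝ} (hx : x ∈ convexHull ℝ A) :
    ∑ i, u i * x i ≤ 1 := by
  have hlin : IsLinearMap ℝ fun y : Fin n → ℝ => ∑ i, u i * y i :=
    ⟨fun y z => by simp only [Pi.add_apply, mul_add, Finset.sum_add_distrib], fun r y => by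
      simp only [Pi.smul_apply, smul_eq_mul, Finset.mul_sum]
      exact Finset.sum_congr rfl fun i _ => by ring⟩
  exact convexHull_min (s := A) hA (convex_halfSpace_le hlin 1) hx

lemma sum_mul_sum_smul {ι : Type*} (s : Finset ι) (w : ι → ℝ) (z : ι → Fin n → ℝ)
    (u : Fin n → ℝ) : ∑ i, u i * (∑ j ∈ s, w j • z j) i = ∑ j ∈ s, w j * ∑ i, u i * z j i := by
  simp only [Finset.sum_apply, Pi.smul_apply, smul_eq_mul, Finset.mul_sum]
  rw [Finset.sum_comm]
  exact Finset.sum_congr rfl fun _ _ => Finset.sum_congr rfl fun _ _ => by ring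

lemma sum_smul_mem_of_zero_mem {E ι : Type*} [AddCommGroup E] [Module ℝ E] {A : Set E}
    (hA : Convex ℝ A) (h0 : 0 ∈ A) (s : Finset ι) {w : ι → ℝ} {z : ι → E}
    (hw : ∀ j ∈ s, 0 ≤ w j) (hw1 : ∑ j ∈ s, w j ≤ 1) (hz : ∀ j ∈ s, z j ∈ A) :
    ∑ j ∈ s, w j • z j ∈ A := by
  rcases (Finset.sum_nonneg hw).eq_or_lt with h | h
  · rw [Finset.sum_eq_zero fun j hj => by
      rw [(Finset.sum_eq_zero_iff_of_nonneg hw).1 h.symm j hj, zero_smul]]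
    exact h0
  · have := hA.smul_mem_of_zero_mem h0 (hA.centerMass_mem hw h hz) ⟨h.le, hw1⟩
    rwa [Finset.centerMass, smul_smul, mul_inv_cancel₀ h.ne', one_smul] at this

/-- The weight missing from 1 is placed at the point 0. -/
lemma sum_add_sum_mem_convexHull {E ι κ : Type*} [AddCommGroup E] [Module ℝ E] {A : Set E}
    (s : Finset ι) (s' : Finset κ) {w : ι → ℝ} {w' : κ → ℝ} {z : ι → E} {z' : κ → E}
    (hw : ∀ j ∈ s, 0 ≤ w j) (hw' : ∀ j ∈ s', 0 ≤ w' j)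
    (hw1 : ∑ j ∈ s, w j + ∑ j ∈ s', w' j ≤ 1) (hz : ∀ j ∈ s, z j ∈ A) (hz' : ∀ j ∈ s', z' j ∈ A) :
    ∑ j ∈ s, w j • z j + ∑ j ∈ s', w' j • z' j ∈ convexHull ℝ (A ∪ {0}) := by
  have hsub := subset_convexHull ℝ (A ∪ {0})
  have := sum_smul_mem_of_zero_mem (convex_convexHull ℝ (A ∪ {0})) (hsub (Or.inr rfl))
    (s.disjSum s') (w := Sum.elim w w') (z := Sum.elim z z') ?_ ?_ ?_
  · rwa [Finset.sum_disjSum] at this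
  · rintro (j | j) hj
    · exact hw j (Finset.inl_mem_disjSum.1 hj)
    · exact hw' j (Finset.inr_mem_disjSum.1 hj)
  · rwa [Finset.sum_disjSum]
  · rintro (j | j) hj
    · exact hsub (Or.inl (hz j (Finset.inl_mem_disjSum.1 hj)))
    · exact hsub (Or.inl (hz' j (Finset.inr_mem_disjSum.1 hj)))

lemma polyCPlus_subset_polyC (hn : 1 ≤ n) : polyCPlus n ⊆ polyC n := by
  refine convexHull_min (Set.union_subset
    (Set.subset_union_left.trans (subset_convexHull ℝ _)) ?_) (convex_convexHull ℝ _)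
  rintro _ rfl
  have h : rootVec n (0, 0) ∈ posRoots n := rootVec_mem_posRoots le_rfl hn
  have := convex_convexHull ℝ (posRoots n ∪ {d | -d ∈ posRoots n})
    (subset_convexHull ℝ _ (Or.inl h))
    (subset_convexHull ℝ _ (Or.inr (show - -rootVec n (0, 0) ∈ posRoots n by rwa [neg_neg])))
    (show (0 : ℝ) ≤ 1 / 2 by norm_num) (show (0 : ℝ) ≤ 1 / 2 by norm_num) (by norm_num)
  rwa [smul_neg, add_neg_cancel] at this

/-- In the polytope of all roots, the coefficients of a point with respect to two families without
adjacent intervals, with disjoint supports, have sum at most `1`. -/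
lemma sum_add_sum_le_one_of_mem_polyC {S S' : Set ℕ} (hS : Disjoint S S')
    {F F' : Finset (ℕ × ℕ)} (hF : IsTiltingFamily o S n F) (hF' : IsTiltingFamily o S' n F')
    {c c' : ℕ × ℕ → ℝ}
    (hx : ∑ I ∈ F, c I • rootVec n I + ∑ I ∈ F', c' I • -rootVec n I ∈ polyC n) :
    ∑ I ∈ F, c I + ∑ I ∈ F', c' I ≤ 1 := by
  classical
  -- On the root of [a, b] the functional is q a - q (b + 1), of absolute value at most 1. Marking
  -- the left ends in F and the positions after the right ends in F' makes it 1 on F and -1 on F';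
  -- non-adjacency and disjoint supports prevent clashes.
  let q : ℕ → ℝ := fun t =>
    if (∃ I ∈ F, I.1 = t) ∨ (∃ I ∈ F', I.2 + 1 = t) then 1 else 0
  have hq0 : ∀ t, 0 ≤ q t := fun t => by simp only [q]; split_ifs <;> norm_num
  have hq1 : ∀ t, q t ≤ 1 := fun t => by simp only [q]; split_ifs <;> norm_num
  have hroot : ∀ I : ℕ × ℕ, I.1 ≤ I.2 → I.2 < n →
      ∑ i : Fin n, (q i - q (i + 1)) * rootVec n I i = q I.1 - q (I.2 + 1) := fun I h1 h2 =>
    sum_mul_rootVec_of_eq (u := fun t => q t - q (t + 1)) h1 h2 fun _ _ _ => rfl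
  have hle := sum_mul_le_one_of_mem_convexHull (fun i : Fin n => q i - q (i + 1)) ?_ hx
  · simp only [Pi.add_apply, mul_add, Finset.sum_add_distrib, sum_mul_sum_smul] at hle
    have hone : ∀ I ∈ F, ∑ i : Fin n, (q i - q (i + 1)) * rootVec n I i = 1 := by
      intro I hI
      rw [hroot I (hF.le I hI) (hF.lt I hI)]
      have h1 : q I.1 = 1 := if_pos (Or.inl ⟨I, hI, rfl⟩)
      have h2 : q (I.2 + 1) = 0 := by
        refine if_neg ?_
        rintro (⟨J, hJ, h⟩ | ⟨J, hJ, h⟩)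
        · exact (hF.extVanish I hI J hJ).1 h.symm
        · refine Set.disjoint_left.1 hS (hF.mem I hI _ (hF.le I hI) le_rfl) ?_
          rw [← Nat.succ_injective h]
          exact hF'.mem J hJ _ (hF'.le J hJ) le_rfl
      rw [h1, h2, sub_zero]
    have hone' : ∀ I ∈ F', ∑ i : Fin n, (q i - q (i + 1)) * (-rootVec n I) i = 1 := by
      intro I hI
      simp only [Pi.neg_apply, mul_neg, Finset.sum_neg_distrib]
      rw [hroot I (hF'.le I hI) (hF'.lt I hI)]
      have h1 : q I.1 = 0 := by
        refine if_neg ?_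
        rintro (⟨J, hJ, h⟩ | ⟨J, hJ, h⟩)
        · refine Set.disjoint_left.1 hS ?_ (hF'.mem I hI _ le_rfl (hF'.le I hI))
          rw [← h]
          exact hF.mem J hJ _ le_rfl (hF.le J hJ)
        · exact (hF'.extVanish J hJ I hI).1 h
      have h2 : q (I.2 + 1) = 1 := if_pos (Or.inr ⟨I, hI, rfl⟩)
      rw [h1, h2, zero_sub, neg_neg]
    rwa [Finset.sum_congr (s₁ := F) rfl (g := c) fun I hI => by rw [hone I hI, mul_one],
      Finset.sum_congr (s₁ := F') rfl (g := c') fun I hI => by rw [hone' I hI, mul_one]] at hle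
  · rintro y (hy | hy)
    · obtain ⟨I, h1, h2, rfl⟩ := exists_of_mem_posRoots hy
      rw [hroot I h1 h2]
      linarith [hq0 (I.2 + 1), hq1 I.1]
    · obtain ⟨I, h1, h2, h⟩ := exists_of_mem_posRoots hy
      rw [← neg_neg y, h]
      simp only [Pi.neg_apply, mul_neg, Finset.sum_neg_distrib]
      rw [hroot I h1 h2]
      linarith [hq1 (I.2 + 1), hq0 I.1]

/-- In the polytope of positive and negative simple roots, the coefficients of a point with respect
to a family without adjacent intervals and negative simple roots off its support have sum at
most `1`. -/
lemma sum_add_sum_le_one_of_mem_polyCClus {S : Set ℕ} [DecidablePred (· ∈ S)]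
    {F : Finset (ℕ × ℕ)} (hF : IsTiltingFamily o S n F) {c : ℕ × ℕ → ℝ} {d : Fin n → ℝ}
    (hx : ∑ I ∈ F, c I • rootVec n I +
      ∑ j ∈ Finset.univ.filter (fun j : Fin n => (j : ℕ) ∉ S), d j • -Pi.single j (1 : ℝ) ∈
        polyCClus n) :
    ∑ I ∈ F, c I + ∑ j ∈ Finset.univ.filter (fun j : Fin n => (j : ℕ) ∉ S), d j ≤ 1 := by
  classical
  let q : ℕ → ℝ := fun t => if ∃ I ∈ F, I.1 = t then 1 else 0
  -- The value -1 off S gives 1 on the negative simple roots there. Since q vanishes off S and is at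
  -- most 1, this stays below the telescoping coefficient, so positive roots still have value at
  -- most 1.
  let u : ℕ → ℝ := fun t => if t ∈ S then q t - q (t + 1) else -1
  have hq0 : ∀ t, 0 ≤ q t := fun t => by simp only [q]; split_ifs <;> norm_num
  have hq1 : ∀ t, q t ≤ 1 := fun t => by simp only [q]; split_ifs <;> norm_num
  have hqS : ∀ t ∉ S, q t = 0 := fun t ht => if_neg fun ⟨I, hI, h⟩ =>
    ht (h ▸ hF.mem I hI _ le_rfl (hF.le I hI))
  have hu : ∀ t, u t ≤ q t - q (t + 1) := fun t => by
    simp only [u]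
    split_ifs with h
    · exact le_rfl
    · linarith [hqS t h, hq1 (t + 1)]
  have hu1 : ∀ t, -1 ≤ u t := fun t => by
    simp only [u]
    split_ifs with h
    · linarith [hq0 t, hq1 (t + 1)]
    · exact le_rfl
  have hsingle : ∀ j : Fin n, ∑ i : Fin n, u i * (-Pi.single j (1 : ℝ) : Fin n → ℝ) i = -u j := by
    intro j
    simp [Pi.single_apply]
  have hle := sum_mul_le_one_of_mem_convexHull (fun i : Fin n => u i) ?_ hx
  · simp only [Pi.add_apply, mul_add, Finset.sum_add_distrib, sum_mul_sum_smul] at hle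
    have hone : ∀ I ∈ F, ∑ i : Fin n, u i * rootVec n I i = 1 := by
      intro I hI
      rw [sum_mul_rootVec_of_eq (q := q) (hF.le I hI) (hF.lt I hI)
        fun t h1 h2 => if_pos (hF.mem I hI t h1 h2)]
      have h1 : q I.1 = 1 := if_pos ⟨I, hI, rfl⟩
      have h2 : q (I.2 + 1) = 0 := if_neg fun ⟨J, hJ, h⟩ => (hF.extVanish I hI J hJ).1 h.symm
      rw [h1, h2, sub_zero]
    rw [Finset.sum_congr (s₁ := F) rfl (g := c) fun I hI => by rw [hone I hI, mul_one],
      Finset.sum_congr rfl (g := d) fun j hj => by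
        rw [hsingle, show u j = -1 from if_neg (Finset.mem_filter.1 hj).2, neg_neg, mul_one]] at hle
    exact hle
  · rintro y (hy | ⟨j, hj⟩)
    · obtain ⟨I, h1, h2, rfl⟩ := exists_of_mem_posRoots hy
      have := sum_mul_rootVec_le h1 h2 hu
      linarith [hq0 (I.2 + 1), hq1 I.1]
    · rw [← neg_neg y, hj, hsingle]
      linarith [hu1 j]

end Polytopes

/-! ### The three equalities -/

section Main

variable {k : Type u} [Field k] {n : ℕ} {Q : Quiver.{v} (Fin n)} {o : ℕ → Prop}

lemma IsLinear.polyPPlus_eq (hQ : IsLinear Q Fin.val o) (hn : 1 ≤ n) :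
    polyPPlus k Q = polyCPlus n := by
  classical
  refine Set.Subset.antisymm ?_ fun x hx => ?_
  · rintro x ⟨T, -, hx⟩
    exact convexHull_mono (Set.union_subset_union_left _ (hQ.summandDims_subset T)) hx
  · have hx0 : ∀ i, 0 ≤ x i := by
      have : polyCPlus n ⊆ Set.Ici (0 : Fin n → ℝ) := by
        refine convexHull_min ?_ (convex_Ici 0)
        rintro y (hy | rfl)
        · obtain ⟨I, -, -, rfl⟩ := exists_of_mem_posRoots hy
          intro i
          simp only [rootVec, Pi.zero_apply]
          split_ifs <;> norm_num
        · exact Set.self_mem_Ici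
      exact this hx
    obtain ⟨F, c, hF, hc, hsum⟩ := exists_isTiltingFamily_sum o Set.univ x fun i _ => hx0 i
    obtain ⟨T, -, -, hT, hroot⟩ := hQ.exists_isSupportTilting (k := k) hF
    have hsum' : x = ∑ I ∈ F, c I • rootVec n I +
        ∑ I ∈ (∅ : Finset (ℕ × ℕ)), c I • -rootVec n I := by
      rw [hsum]
      funext i
      simp
    -- An empty negative part reduces the bound to the one for the polytope of all roots, which
    -- contains C⁺.
    have hempty : IsTiltingFamily o ∅ n ∅ :=
      ⟨by simp, by simp, by simp, by simp, by simp, by simp⟩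
    have h1 := sum_add_sum_le_one_of_mem_polyC (by simp) hF hempty
      (hsum' ▸ polyCPlus_subset_polyC hn hx)
    refine ⟨T, hT rfl, ?_⟩
    rw [hsum']
    exact sum_add_sum_mem_convexHull _ _ (fun I _ => hc I) (fun I _ => hc I) h1 hroot (by simp)

lemma IsLinear.polyPClus_eq (hQ : IsLinear Q Fin.val o) (hn : 1 ≤ n) :
    polyPClus k Q = polyCClus n := by
  classical
  have hsimple : ∀ j : Fin n, (-Set.indicator {j} 1 : Fin n → ℝ) = -Pi.single j 1 := fun j => by
    rw [Set.indicator_singleton, Pi.one_apply]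
  refine Set.Subset.antisymm ?_ fun x hx => ?_
  · rintro x ⟨T, -, hx⟩
    refine convexHull_min (Set.union_subset (Set.union_subset ?_ ?_) ?_)
      (convex_convexHull ℝ _) hx
    · exact (hQ.summandDims_subset T).trans
        (Set.subset_union_left.trans (subset_convexHull ℝ _))
    · rintro _ ⟨j, -, rfl⟩
      exact subset_convexHull ℝ _ (Or.inr ⟨j, by rw [hsimple, neg_neg]⟩)
    · rintro _ rfl
      -- The origin is not among the generators of C^clus; it is the midpoint of a simple root and
      -- its negative.
      let j : Fin n := ⟨0, hn⟩
      have h : rootVec n (0, 0) = Pi.single j 1 := by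
        funext i
        rw [rootVec, Pi.single_apply]
        exact if_congr (by simp [Fin.ext_iff, j]) rfl rfl
      have := convex_convexHull ℝ (posRoots n ∪ {d | -d ∈ simpleRoots n})
        (subset_convexHull ℝ _ (Or.inl (rootVec_mem_posRoots (I := (0, 0)) le_rfl hn)))
        (subset_convexHull ℝ _ (Or.inr (show - -rootVec n (0, 0) ∈ simpleRoots n from
          ⟨j, by rw [neg_neg, h]⟩)))
        (show (0 : ℝ) ≤ 1 / 2 by norm_num) (show (0 : ℝ) ≤ 1 / 2 by norm_num) (by norm_num)
      rwa [smul_neg, add_neg_cancel] at this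
  · let S : Set ℕ := {t | ∀ h : t < n, 0 ≤ x ⟨t, h⟩}
    obtain ⟨F, c, hF, hc, hsum⟩ := exists_isTiltingFamily_sum o S x fun i hi => hi i.2
    obtain ⟨T, hT, hsupp, -, hroot⟩ := hQ.exists_isSupportTilting (k := k) hF
    have hsum' : x = ∑ I ∈ F, c I • rootVec n I +
        ∑ j ∈ Finset.univ.filter (fun j : Fin n => (j : ℕ) ∉ S), (-x j) • -Pi.single j (1 : ℝ) := by
      rw [hsum]
      funext i
      rw [Pi.add_apply, Finset.sum_apply]
      simp only [Pi.smul_apply, Pi.neg_apply, Pi.single_apply, smul_eq_mul, mul_neg,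
        mul_ite, mul_one, mul_zero]
      rw [Finset.sum_neg_distrib, Finset.sum_ite_eq]
      by_cases hi : (i : ℕ) ∈ S <;> simp [hi]
    have hneg : ∀ j : Fin n, (j : ℕ) ∉ S → 0 ≤ -x j := fun j hj => by
      by_contra h
      exact hj fun _ => by simp only [Fin.eta]; linarith
    have h1 := sum_add_sum_le_one_of_mem_polyCClus hF (hsum' ▸ hx)
    refine ⟨T, hT, ?_⟩
    rw [hsum']
    refine sum_add_sum_mem_convexHull _ _ (fun I _ => hc I)
      (fun j hj => hneg j (Finset.mem_filter.1 hj).2) h1 (fun I hI => Or.inl (hroot I hI))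
      fun j hj => Or.inr ⟨j, ?_, (hsimple j).symm⟩
    rw [hsupp]
    exact (Finset.mem_filter.1 hj).2

lemma IsLinear.polyP_eq (hQ : IsLinear Q Fin.val o) (hn : 1 ≤ n) :
    polyP k Q = polyC n := by
  classical
  refine Set.Subset.antisymm ?_ fun x hx => ?_
  · rintro x ⟨T, T', -, hx⟩
    refine convexHull_min (Set.union_subset (Set.union_subset ?_ ?_) ?_)
      (convex_convexHull ℝ _) hx
    · exact (hQ.summandDims_subset T).trans
        (Set.subset_union_left.trans (subset_convexHull ℝ _))
    · exact fun d hd => subset_convexHull ℝ _ (Or.inr (hQ.summandDims_subset T' hd))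
    · rintro _ rfl
      exact polyCPlus_subset_polyC hn (subset_convexHull ℝ _ (Or.inr rfl))
  -- Positions from n on belong to S vacuously; families only use positions below n. Zero
  -- coordinates go to S, so the two supports are complementary.
  · let S : Set ℕ := {t | ∀ h : t < n, 0 ≤ x ⟨t, h⟩}
    obtain ⟨F, c, hF, hc, hsum⟩ := exists_isTiltingFamily_sum o S x fun i hi => hi i.2
    obtain ⟨F', c', hF', hc', hsum₁⟩ := exists_isTiltingFamily_sum o Sᶜ (-x) fun i hi => by
      by_contra h
      refine hi fun _ => ?_
      rw [Pi.neg_apply] at h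
      simp only [Fin.eta]
      linarith
    obtain ⟨T, hT, hsupp, -, hroot⟩ := hQ.exists_isSupportTilting (k := k) hF
    obtain ⟨T', hT', hsupp', -, hroot'⟩ := hQ.exists_isSupportTilting (k := k) hF'
    have hsum' : x = ∑ I ∈ F, c I • rootVec n I + ∑ I ∈ F', c' I • -rootVec n I := by
      simp only [smul_neg, Finset.sum_neg_distrib]
      rw [hsum, hsum₁]
      funext i
      by_cases hi : (i : ℕ) ∈ S <;> simp [hi]
    have h1 := sum_add_sum_le_one_of_mem_polyC disjoint_compl_right hF hF' (hsum' ▸ hx)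
    refine ⟨T, T', ⟨hT, hT', ?_⟩, ?_⟩
    · rw [hsupp, hsupp', Set.preimage_compl]
      exact isCompl_compl
    · rw [hsum']
      refine sum_add_sum_mem_convexHull _ _ (fun I _ => hc I) (fun I _ => hc' I) h1
        (fun I hI => Or.inl (hroot I hI)) fun I hI => Or.inr ?_
      change - -rootVec n I ∈ summandDims T'
      rw [neg_neg]
      exact hroot' I hI

end Main

end QuiverTilting

end


theorem mainTheorem1 {k : Type u} [Field k] {n : ℕ} (hn : 1 ≤ n)
    (Q : Quiver.{v} (Fin n)) (hQ : QuiverTilting.IsTypeA Q) :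
    (QuiverTilting.polyP k Q = QuiverTilting.polyC n ∧
      QuiverTilting.polyPClus k Q = QuiverTilting.polyCClus n ∧
      QuiverTilting.polyPPlus k Q = QuiverTilting.polyCPlus n) ∧
    (∀ Q' : Quiver.{v'} (Fin n), QuiverTilting.IsTypeA Q' →
      QuiverTilting.polyP k Q = QuiverTilting.polyP k Q' ∧
      QuiverTilting.polyPClus k Q = QuiverTilting.polyPClus k Q' ∧
      QuiverTilting.polyPPlus k Q = QuiverTilting.polyPPlus k Q') := by
  obtain ⟨o, ho⟩ := hQ.exists_isLinear
  refine ⟨⟨ho.polyP_eq hn, ho.polyPClus_eq hn, ho.polyPPlus_eq hn⟩, fun Q' hQ' => ?_⟩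
  obtain ⟨o', ho'⟩ := hQ'.exists_isLinear
  rw [ho.polyP_eq hn, ho.polyPClus_eq hn, ho.polyPPlus_eq hn, ho'.polyP_eq hn,
    ho'.polyPClus_eq hn, ho'.polyPPlus_eq hn]
  exact ⟨rfl, rfl, rfl⟩
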